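/- For finite simple graphs $H,G$ let $t(H,G)=|\mathrm{hom}(H,G)|/|V(G)|^{|V(H)|}$ be the homomorphism density. A graphon is a symmetric measurable function $f:[0,1]^2\to[0,1]$, and for a graph $H$ on $\{1,\dots,m\}$ let $t(H,f)=\int_{[0,1]^m}\prod_{\{i,j\}\in E(H)}f(x_i,x_j)\,dx_1\cdots dx_m$. For $G$ a graph or a graphon, put $t(G)=(t(K_2,G),t(K_3,G))\in\mathbb R^2$. For $n\ge 1$ let $S_n$ be the set of all $t(G)$ with $G$ a simple graph on $n$ labelled nodes, and $P_n=\mathrm{conv}(S_n)$; let $R=\{t(f): f \text{ a graphon}\}$ and $P=\mathrm{conv}(R)$. For $k\ge 0$ let $v_{k,n}=t(T(n,k+1))$, where $T(n,r)$ is the Turán graph on $n$ nodes with $r$ classes, let $L_{k,n}$ be the closed segment joining $v_{k,n}$ and $v_{k+1,n}$, and let $v_k=t(f^{K_{k+1}})$, where $f^{K_r}$ is the Turán graphon with $r$ classes: $f^{K_1}=0$, and for $r\ge2$, $f^{K_r}(x,y)=1$ if $\lfloor rx\rfloor\ne\lfloor ry\rfloor$ and $0$ otherwise. 1. For every $n\ge1$,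 $P_n$ is the convex hull of the points $v_{k,n}$, $k=0,1,\dots,\lceil n/2\rceil-1$, together with $v_{n-1,n}$. 2. $P$ is compact, and $\lim_{n\to\infty}P_n=P$ in the Hausdorff distance. 3. Let $k\ge0$ and let $n\ge1$ be a multiple of $(k+1)(k+2)$. Then $v_{k,n}=v_k$ and $v_{k+1,n}=v_{k+1}$. If moreover $k\ge1$, then $L_{k,n}\cap S_n=\{v_k,v_{k+1}\}$. -/

import Mathlib

open MeasureTheory Filter Topology
open scoped unitInterval

noncomputable section

namespace EdgeTriangle

/-- The homomorphism density `t(H, G) = |hom(H, G)| / |V(G)| ^ |V(H)|`. -/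
def homDensity {m n : ℕ} (H : SimpleGraph (Fin m)) (G : SimpleGraph (Fin n)) : ℝ :=
  (Nat.card (H →g G) : ℝ) / (n : ℝ) ^ m

/-- Graphons: symmetric measurable functions from `[0,1]²` into `[0,1]`. -/
structure Graphon where
  toFun : I → I → ℝ
  measurable_toFun : Measurable fun p : I × I => toFun p.1 p.2
  symm : ∀ x y, toFun x y = toFun y x
  mem_Icc : ∀ x y, toFun x y ∈ Set.Icc (0 : ℝ) 1

/-- The factor `f(x_i, x_j)` attached to the unordered pair `{i, j}`. -/
def Graphon.pairValue (f : Graphon) {m : ℕ} (x : Fin m → I) : Sym2 (Fin m) → ℝ :=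
  Sym2.lift ⟨fun i j => f.toFun (x i) (x j), fun i j => f.symm (x i) (x j)⟩

/-- The homomorphism density of `H` in a graphon:
`t(H, f) = ∫_{[0,1]^m} ∏_{{i,j} ∈ E(H)} f(x_i, x_j) dx`. -/
def Graphon.homDensity (f : Graphon) {m : ℕ} (H : SimpleGraph (Fin m))
    [DecidableRel H.Adj] : ℝ :=
  ∫ x : Fin m → I, ∏ e ∈ H.edgeFinset, f.pairValue x e

/-- The edge-triangle density vector of a graph on `n` labelled nodes. -/
def tGraph {n : ℕ} (G : SimpleGraph (Fin n)) : EuclideanSpace ℝ (Fin 2) :=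
  !₂[EdgeTriangle.homDensity (⊤ : SimpleGraph (Fin 2)) G,
     EdgeTriangle.homDensity (⊤ : SimpleGraph (Fin 3)) G]

/-- The edge-triangle density vector of a graphon. -/
def tGraphon (f : Graphon) : EuclideanSpace ℝ (Fin 2) :=
  !₂[f.homDensity (⊤ : SimpleGraph (Fin 2)), f.homDensity (⊤ : SimpleGraph (Fin 3))]

/-- The density vectors of all simple graphs on `n` nodes. -/
def S (n : ℕ) : Set (EuclideanSpace ℝ (Fin 2)) :=
  Set.range fun G : SimpleGraph (Fin n) => tGraph G

/-- The convex hull of the density vectors of all simple graphs on `n` nodes. -/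
def Pn (n : ℕ) : Set (EuclideanSpace ℝ (Fin 2)) :=
  convexHull ℝ (S n)

/-- All realizable edge-triangle density vectors of graphons. -/
def R : Set (EuclideanSpace ℝ (Fin 2)) :=
  Set.range tGraphon

/-- The convex hull of all realizable edge-triangle density vectors. -/
def P : Set (EuclideanSpace ℝ (Fin 2)) :=
  convexHull ℝ R

/-- The identically zero graphon. -/
def zeroGraphon : Graphon where
  toFun _ _ := 0
  measurable_toFun := measurable_const
  symm _ _ := rfl
  mem_Icc _ _ := ⟨le_rfl, zero_le_one⟩

/-- The Turán graphon with `k` classes: the zero graphon for `k = 1`, and otherwise the indicator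
of `⌊x k⌋ ≠ ⌊y k⌋`. -/
def turanGraphon (k : ℕ) : Graphon :=
  if k = 1 then zeroGraphon else
  { toFun := fun x y => if ⌊(x : ℝ) * k⌋ = ⌊(y : ℝ) * k⌋ then 0 else 1
    measurable_toFun := by
      refine Measurable.ite (measurableSet_eq_fun ?_ ?_) measurable_const measurable_const
      · exact Int.measurable_floor.comp ((measurable_subtype_coe.comp measurable_fst).mul_const _)
      · exact Int.measurable_floor.comp ((measurable_subtype_coe.comp measurable_snd).mul_const _)
    symm := fun x y => by simp only [eq_comm]
    mem_Icc := fun x y => by split_ifs <;> simp }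

/-- The density vector of the Turán graphon with `k + 1` classes. -/
def v (k : ℕ) : EuclideanSpace ℝ (Fin 2) :=
  tGraphon (turanGraphon (k + 1))

/-- The density vector of the Turán graph on `n` nodes with `k + 1` classes. -/
def vn (k n : ℕ) : EuclideanSpace ℝ (Fin 2) :=
  tGraph (SimpleGraph.turanGraph n (k + 1))

/-- The segment joining the density vectors of the Turán graphs on `n` nodes with `k + 1` and
`k + 2` classes. -/
def Ln (k n : ℕ) : Set (EuclideanSpace ℝ (Fin 2)) :=
  segment ℝ (vn k n) (vn (k + 1) n)

end EdgeTriangle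

end

/-! A linear functional of the density vector is, up to scaling, a polynomial `energy a b G`
evaluated at the constant weight 1, so everything rests on minimizing `energy` over integer vertex
weights of fixed total.

Symmetrization: shifting weight between two nonadjacent vertices changes the energy affinely, so one
of the two merges does not raise it; this leads to weights supported on a clique. There,
redistributing the weight of two vertices changes the energy by a constant times the change of their
product, so either merging or balancing helps. The outcome (`exists_balanced_clique`) is the list of
class sizes of a Turán graph. By Hahn–Banach, `Pn` is then the hull of the Turán vectors; those with
classes of sizes 1 and 2 only lie on one segment, which leaves the stated vertices.

Chords: let `A = n / (k + 1)` and `B = n / (k + 2)`. The functional vanishing on the chord becomes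
`chordEnergy`, equal to `2 ∑ μ (μ - A) (μ - B)` on clique weights. A balanced list of total `n` has
no size strictly between `B` and `A`, so `chordEnergy` is nonnegative everywhere. If it vanishes at
`G`, the first-order variations between nonadjacent vertices vanish, and the second-order ones show
that nonadjacency is transitive (`not_adj_trans_of_chordEnergy_eq_zero`). Hence `G` is complete
multipartite, its classes are balanced, and all have size `A` or all have size `B`.

Limit: step graphons give `Pn ⊆ P`. Conversely, the expected density vector of a random `n`-vertex
graph sampled from a graphon lies in `Pn` and differs from that of the graphon by `O(1/n)`. Since
Turán vectors converge uniformly in `k`, `P` is the hull of the convergent sequence `v k` together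
with its limit, which is compact. -/

set_option linter.unusedSectionVars false

noncomputable section

namespace EdgeTriangle

/-! ### Weighted edge and triangle counts -/

section Weighted

variable {V W : Type*} [Fintype V] [DecidableEq V] [Fintype W] [DecidableEq W]

open Classical in
/-- The adjacency indicator of a graph. -/
def adj (G : SimpleGraph V) (x y : V) : ℝ := if G.Adj x y then 1 else 0

lemma adj_comm (G : SimpleGraph V) (x y : V) : adj G x y = adj G y x := by
  classical
  unfold adj
  exact if_congr (G.adj_comm x y) rfl rfl

lemma adj_of_adj {G : SimpleGraph V} {x y : V} (h : G.Adj x y) : adj G x y = 1 := if_pos h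

lemma adj_of_not_adj {G : SimpleGraph V} {x y : V} (h : ¬ G.Adj x y) : adj G x y = 0 := if_neg h

lemma adj_self (G : SimpleGraph V) (x : V) : adj G x x = 0 := adj_of_not_adj (G.irrefl)

/-- The bilinear form counting edges. -/
def edgeForm (G : SimpleGraph V) (f g : V → ℝ) : ℝ := ∑ x, ∑ y, f x * g y * adj G x y

/-- The trilinear form counting triangles. -/
def triForm (G : SimpleGraph V) (f g h : V → ℝ) : ℝ :=
  ∑ x, ∑ y, ∑ z, f x * g y * h z * (adj G x y * adj G y z * adj G x z)

lemma edgeForm_comm (G : SimpleGraph V) (f g : V → ℝ) : edgeForm G f g = edgeForm G g f := by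
  unfold edgeForm
  rw [Finset.sum_comm]
  refine Finset.sum_congr rfl fun x _ => Finset.sum_congr rfl fun y _ => ?_
  rw [adj_comm G y x]; ring

lemma triForm_swap_right (G : SimpleGraph V) (f g h : V → ℝ) :
    triForm G f g h = triForm G f h g := by
  unfold triForm
  refine Finset.sum_congr rfl fun x _ => ?_
  rw [Finset.sum_comm]
  refine Finset.sum_congr rfl fun y _ => Finset.sum_congr rfl fun z _ => ?_
  rw [adj_comm G z y]; ring

lemma triForm_swap_left (G : SimpleGraph V) (f g h : V → ℝ) :
    triForm G f g h = triForm G g f h := by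
  unfold triForm
  rw [Finset.sum_comm]
  refine Finset.sum_congr rfl fun x _ => Finset.sum_congr rfl fun y _ =>
    Finset.sum_congr rfl fun z _ => ?_
  rw [adj_comm G y x]; ring

lemma edgeForm_add_left (G : SimpleGraph V) (f f' g : V → ℝ) :
    edgeForm G (f + f') g = edgeForm G f g + edgeForm G f' g := by
  simp only [edgeForm, Pi.add_apply, add_mul, Finset.sum_add_distrib]

lemma edgeForm_add_right (G : SimpleGraph V) (f g g' : V → ℝ) :
    edgeForm G f (g + g') = edgeForm G f g + edgeForm G f g' := by
  simp only [edgeForm, Pi.add_apply, add_mul, mul_add, Finset.sum_add_distrib]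

lemma triForm_add_left (G : SimpleGraph V) (f f' g h : V → ℝ) :
    triForm G (f + f') g h = triForm G f g h + triForm G f' g h := by
  simp only [triForm, Pi.add_apply, add_mul, Finset.sum_add_distrib]

lemma triForm_add_middle (G : SimpleGraph V) (f g g' h : V → ℝ) :
    triForm G f (g + g') h = triForm G f g h + triForm G f g' h := by
  simp only [triForm, Pi.add_apply, add_mul, mul_add, Finset.sum_add_distrib]

lemma triForm_add_right (G : SimpleGraph V) (f g h h' : V → ℝ) :
    triForm G f g (h + h') = triForm G f g h + triForm G f g h' := by
  simp only [triForm, Pi.add_apply, add_mul, mul_add, Finset.sum_add_distrib]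

lemma edgeForm_smul_right (G : SimpleGraph V) (t : ℝ) (f g : V → ℝ) :
    edgeForm G f (t • g) = t * edgeForm G f g := by
  simp only [edgeForm, Pi.smul_apply, smul_eq_mul, Finset.mul_sum]
  refine Finset.sum_congr rfl fun x _ => Finset.sum_congr rfl fun y _ => by ring

lemma triForm_smul_right (G : SimpleGraph V) (t : ℝ) (f g h : V → ℝ) :
    triForm G f g (t • h) = t * triForm G f g h := by
  simp only [triForm, Pi.smul_apply, smul_eq_mul, Finset.mul_sum]
  refine Finset.sum_congr rfl fun x _ => Finset.sum_congr rfl fun y _ =>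
    Finset.sum_congr rfl fun z _ => by ring

/-- A weight function whose support is an independent set. -/
def IndepSupport (G : SimpleGraph V) (e : V → ℝ) : Prop :=
  ∀ x y, e x ≠ 0 → e y ≠ 0 → ¬ G.Adj x y

/-- A weight function whose support is a clique. -/
def CliqueSupport (G : SimpleGraph V) (f : V → ℝ) : Prop :=
  ∀ x y, f x ≠ 0 → f y ≠ 0 → x ≠ y → G.Adj x y

lemma IndepSupport.smul {G : SimpleGraph V} {e : V → ℝ} (he : IndepSupport G e) (t : ℝ) :
    IndepSupport G (t • e) := fun x y hx hy =>
  he x y (fun h => hx (by simp [h])) (fun h => hy (by simp [h]))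

lemma IndepSupport.edgeForm_eq_zero {G : SimpleGraph V} {e : V → ℝ} (he : IndepSupport G e) :
    edgeForm G e e = 0 := by
  refine Finset.sum_eq_zero fun x _ => Finset.sum_eq_zero fun y _ => ?_
  by_cases hx : e x = 0
  · simp [hx]
  by_cases hy : e y = 0
  · simp [hy]
  simp [adj_of_not_adj (he x y hx hy)]

lemma IndepSupport.triForm_eq_zero {G : SimpleGraph V} {e : V → ℝ} (he : IndepSupport G e)
    (h : V → ℝ) : triForm G e e h = 0 := by
  refine Finset.sum_eq_zero fun x _ => Finset.sum_eq_zero fun y _ =>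
    Finset.sum_eq_zero fun z _ => ?_
  by_cases hx : e x = 0
  · simp [hx]
  by_cases hy : e y = 0
  · simp [hy]
  simp [adj_of_not_adj (he x y hx hy)]

/-- The linear combination of the weighted edge and triangle counts with coefficients `a`, `b`. -/
def energy (a b : ℝ) (G : SimpleGraph V) (f : V → ℝ) : ℝ :=
  a * edgeForm G f f + b * triForm G f f f

/-- The directional derivative of the energy at `f` in the direction `e`. -/
def slope (a b : ℝ) (G : SimpleGraph V) (f e : V → ℝ) : ℝ :=
  2 * a * edgeForm G f e + 3 * b * triForm G f f e

/-- Every term containing two copies of `e`, or two of `e'`, vanishes because the support is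
independent; only the first-order and mixed terms survive. With one direction this makes the energy
affine along it. -/
lemma energy_add_add {a b : ℝ} {G : SimpleGraph V} {e e' : V → ℝ} (he : IndepSupport G e)
    (he' : IndepSupport G e') (f : V → ℝ) :
    energy a b G (f + e + e') = energy a b G f + slope a b G f e + slope a b G f e' +
      2 * a * edgeForm G e e' + 6 * b * triForm G f e e' := by
  have h1 := he.edgeForm_eq_zero
  have h2 := he'.edgeForm_eq_zero
  have h3 := he.triForm_eq_zero
  have h4 := he'.triForm_eq_zero
  have c1 : ∀ h, triForm G h e e = 0 := fun h => by
    rw [triForm_swap_left, triForm_swap_right, h3]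
  have c2 : ∀ h, triForm G h e' e' = 0 := fun h => by
    rw [triForm_swap_left, triForm_swap_right, h4]
  have c3 : ∀ h, triForm G e h e = 0 := fun h => by rw [triForm_swap_right, h3]
  have c4 : ∀ h, triForm G e' h e' = 0 := fun h => by rw [triForm_swap_right, h4]
  have s1 : triForm G f e f = triForm G f f e := triForm_swap_right ..
  have s2 : triForm G e f f = triForm G f f e := by rw [triForm_swap_left, s1]
  have s3 : triForm G f e' f = triForm G f f e' := triForm_swap_right ..
  have s4 : triForm G e' f f = triForm G f f e' := by rw [triForm_swap_left, s3]
  have s5 : triForm G f e' e = triForm G f e e' := triForm_swap_right ..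
  have s6 : triForm G e f e' = triForm G f e e' := triForm_swap_left ..
  have s7 : triForm G e' f e = triForm G f e e' := by rw [triForm_swap_left, s5]
  have s8 : triForm G e e' f = triForm G f e e' := by rw [triForm_swap_right, s6]
  have s9 : triForm G e' e f = triForm G f e e' := by rw [triForm_swap_right, s7]
  simp only [energy, slope, edgeForm_add_left, edgeForm_add_right, triForm_add_left,
    triForm_add_middle, triForm_add_right, h1, h2, h3, h4, c1, c2, c3, c4, s1, s2, s3, s4, s5, s6,
    s7, s8, s9, edgeForm_comm G e f, edgeForm_comm G e' f, edgeForm_comm G e' e]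
  ring

lemma energy_add_smul {a b : ℝ} {G : SimpleGraph V} {e : V → ℝ} (he : IndepSupport G e)
    (f : V → ℝ) (t : ℝ) :
    energy a b G (f + t • e) = energy a b G f + t * slope a b G f e := by
  have h0 : IndepSupport G (0 : V → ℝ) := fun x y hx => (hx rfl).elim
  have h := energy_add_add (a := a) (b := b) (he.smul t) h0 f
  have z1 : slope a b G f 0 = 0 := by simp [slope, edgeForm, triForm]
  have z2 : edgeForm G (t • e) 0 = 0 := by simp [edgeForm]
  have z3 : triForm G f (t • e) 0 = 0 := by simp [triForm]
  rw [z1, z2, z3, add_zero] at h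
  rw [h, slope, slope, edgeForm_smul_right, triForm_smul_right]
  ring

lemma CliqueSupport.edgeForm_eq {G : SimpleGraph V} {f : V → ℝ} (hf : CliqueSupport G f) :
    edgeForm G f f = (∑ x, f x) ^ 2 - ∑ x, f x ^ 2 := by
  have h : ∀ x y, f x * f y * adj G x y = f x * f y - if x = y then f x ^ 2 else 0 := by
    intro x y
    by_cases hxy : x = y
    · subst hxy; simp [adj_self]; ring
    by_cases hx : f x = 0
    · simp [hx]
    by_cases hy : f y = 0
    · simp [hy, hxy]
    simp [adj_of_adj (hf x y hx hy hxy), hxy]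
  simp only [edgeForm, h, Finset.sum_sub_distrib, Finset.sum_ite_eq, Finset.mem_univ, if_true]
  rw [sq, Finset.sum_mul_sum]

lemma CliqueSupport.triForm_eq {G : SimpleGraph V} {f : V → ℝ} (hf : CliqueSupport G f) :
    triForm G f f f = (∑ x, f x) ^ 3 - 3 * (∑ x, f x) * (∑ x, f x ^ 2) + 2 * ∑ x, f x ^ 3 := by
  have h : ∀ x y, f x * f y * adj G x y = f x * f y * if x = y then 0 else 1 := by
    intro x y
    by_cases hxy : x = y
    · subst hxy; simp [adj_self]
    by_cases hx : f x = 0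
    · simp [hx]
    by_cases hy : f y = 0
    · simp [hy]
    simp [adj_of_adj (hf x y hx hy hxy), hxy]
  -- Inclusion–exclusion over coincidences: on `x = y = z` the term is subtracted three times, hence
  -- the correction with factor 2.
  have h3 : ∀ x y z, f x * f y * f z * (adj G x y * adj G y z * adj G x z) =
      f x * f y * f z - (if x = y then f x ^ 2 * f z else 0) - (if y = z then f x * f y ^ 2 else 0)
        - (if x = z then f x ^ 2 * f y else 0)
        + (if x = y then if y = z then 2 * f x ^ 3 else 0 else 0) := by
    intro x y z
    have e1 : f x * f y * f z * (adj G x y * adj G y z * adj G x z) =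
        (f x * f y * adj G x y) * f z * adj G y z * adj G x z := by ring
    rw [e1, h x y]
    by_cases hxy : x = y
    · subst hxy
      by_cases hxz : x = z
      · subst hxz; simp; ring
      · simp [hxz]; ring
    have e2 : f x * f y * (if x = y then (0 : ℝ) else 1) * f z * adj G y z * adj G x z =
        f x * (f y * f z * adj G y z) * adj G x z := by rw [if_neg hxy]; ring
    rw [e2, h y z]
    by_cases hyz : y = z
    · subst hyz; simp [hxy]; ring
    have e3 : f x * (f y * f z * if y = z then (0 : ℝ) else 1) * adj G x z =
        f y * (f x * f z * adj G x z) := by rw [if_neg hyz]; ring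
    rw [e3, h x z]
    by_cases hxz : x = z
    · subst hxz; simp [hxy, Ne.symm hxy]; ring
    · simp [hxy, hyz, hxz]; ring
  simp only [triForm, h3, Finset.sum_sub_distrib, Finset.sum_add_distrib]
  have t1 : ∑ x, ∑ y, ∑ z, f x * f y * f z = (∑ x, f x) ^ 3 := by
    rw [pow_three, Finset.sum_mul_sum, Finset.sum_mul_sum]
    refine Finset.sum_congr rfl fun x _ => ?_
    refine Finset.sum_congr rfl fun y _ => ?_
    rw [Finset.mul_sum]
    exact Finset.sum_congr rfl fun z _ => by ring
  have t2 : ∑ x, ∑ y, ∑ z, (if x = y then f x ^ 2 * f z else 0) =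
      (∑ x, f x) * ∑ x, f x ^ 2 := by
    rw [mul_comm, Finset.sum_mul_sum]
    refine Finset.sum_congr rfl fun x _ => ?_
    rw [Finset.sum_comm]
    simp
  have t3 : ∑ x, ∑ y, ∑ z, (if y = z then f x * f y ^ 2 else 0) =
      (∑ x, f x) * ∑ x, f x ^ 2 := by
    rw [Finset.sum_mul_sum]
    simp
  have t4 : ∑ x, ∑ y, ∑ z, (if x = z then f x ^ 2 * f y else 0) =
      (∑ x, f x) * ∑ x, f x ^ 2 := by
    rw [mul_comm, Finset.sum_mul_sum]
    simp
  have t5 : ∑ x, ∑ y, ∑ z, (if x = y then if y = z then 2 * f x ^ 3 else 0 else 0) =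
      2 * ∑ x, f x ^ 3 := by
    rw [Finset.mul_sum]
    refine Finset.sum_congr rfl fun x _ => ?_
    rw [Finset.sum_comm]
    simp
  rw [t1, t2, t3, t4, t5]
  ring

/-! ### Blow-ups as weighted graphs. -/

/-- The number of preimages of a vertex, as a weight function. -/
def fiberCard (c : V → W) (w : W) : ℕ := (Finset.univ.filter fun v => c v = w).card

lemma sum_comp_eq_sum_fiberCard (c : V → W) (g : W → ℝ) :
    ∑ v, g (c v) = ∑ w, (fiberCard c w : ℝ) * g w := by
  rw [← Finset.sum_fiberwise Finset.univ c]
  refine Finset.sum_congr rfl fun w _ => ?_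
  rw [Finset.sum_congr rfl (g := fun _ => g w) fun v hv => by rw [(Finset.mem_filter.1 hv).2]]
  simp [fiberCard]

lemma sum_fiberCard (c : V → W) : ∑ w, fiberCard c w = Fintype.card V := by
  have := sum_comp_eq_sum_fiberCard c fun _ => 1
  simp only [mul_one, Finset.sum_const, Finset.card_univ, nsmul_eq_mul] at this
  exact_mod_cast this.symm

lemma adj_comap (c : V → W) (H : SimpleGraph W) (x y : V) :
    adj (H.comap c) x y = adj H (c x) (c y) := by
  classical
  unfold adj
  exact if_congr SimpleGraph.comap_adj rfl rfl

lemma edgeForm_comap (c : V → W) (H : SimpleGraph W) :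
    edgeForm (H.comap c) 1 1 = edgeForm H (fun w => fiberCard c w) (fun w => fiberCard c w) := by
  simp only [edgeForm, adj_comap, Pi.one_apply, one_mul]
  rw [sum_comp_eq_sum_fiberCard c fun x => ∑ y, adj H x (c y)]
  refine Finset.sum_congr rfl fun x _ => ?_
  rw [sum_comp_eq_sum_fiberCard c fun y => adj H x y, Finset.mul_sum]
  exact Finset.sum_congr rfl fun y _ => by ring

lemma triForm_comap (c : V → W) (H : SimpleGraph W) :
    triForm (H.comap c) 1 1 1 = triForm H (fun w => fiberCard c w) (fun w => fiberCard c w)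
      (fun w => fiberCard c w) := by
  simp only [triForm, adj_comap, Pi.one_apply, one_mul]
  rw [sum_comp_eq_sum_fiberCard c fun x =>
    ∑ y, ∑ z, adj H x (c y) * adj H (c y) (c z) * adj H x (c z)]
  refine Finset.sum_congr rfl fun x _ => ?_
  rw [sum_comp_eq_sum_fiberCard c fun y => ∑ z, adj H x y * adj H y (c z) * adj H x (c z),
    Finset.mul_sum]
  refine Finset.sum_congr rfl fun y _ => ?_
  rw [sum_comp_eq_sum_fiberCard c fun z => adj H x y * adj H y z * adj H x z, Finset.mul_sum,
    Finset.mul_sum]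
  exact Finset.sum_congr rfl fun z _ => by ring

end Weighted

/-! ### Shifting weights -/

section Shift

variable {V : Type*} [Fintype V] [DecidableEq V]

/-- Change the weights of `p` and `q` to `i` and `j`. -/
def setPair (μ : V → ℕ) (p q : V) (i j : ℕ) : V → ℕ :=
  Function.update (Function.update μ p i) q j

lemma setPair_left {p q : V} (hpq : p ≠ q) (μ : V → ℕ) (i j : ℕ) : setPair μ p q i j p = i := by
  simp [setPair, hpq]

lemma setPair_right (p q : V) (μ : V → ℕ) (i j : ℕ) : setPair μ p q i j q = j := by
  simp [setPair]

lemma setPair_of_ne {p q x : V} (hp : x ≠ p) (hq : x ≠ q) (μ : V → ℕ) (i j : ℕ) :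
    setPair μ p q i j x = μ x := by
  simp [setPair, hp, hq]

lemma sum_setPair {p q : V} (hpq : p ≠ q) (μ : V → ℕ) (i j : ℕ) (g : V → ℕ → ℝ) :
    ∑ x, g x (setPair μ p q i j x) =
      ∑ x, g x (μ x) + (g p i - g p (μ p)) + (g q j - g q (μ q)) := by
  have h : ∀ x, g x (setPair μ p q i j x) = g x (μ x) +
      (if x = p then g p i - g p (μ p) else 0) + (if x = q then g q j - g q (μ q) else 0) := by
    intro x
    by_cases hp : x = p
    · subst hp; simp [setPair_left hpq, hpq]
    by_cases hq : x = q
    · subst hq; simp [setPair_right, hp]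
    simp [setPair_of_ne hp hq, hp, hq]
  simp [h, Finset.sum_add_distrib]

lemma sum_setPair_eq {p q : V} (hpq : p ≠ q) {μ : V → ℕ} {i j : ℕ} (h : i + j = μ p + μ q) :
    ∑ x, setPair μ p q i j x = ∑ x, μ x := by
  have := sum_setPair hpq μ i j fun _ k => (k : ℝ)
  have h' : (i : ℝ) + j = μ p + μ q := by exact_mod_cast h
  have h2 : ∑ x, (setPair μ p q i j x : ℝ) = ∑ x, (μ x : ℝ) := by rw [this]; linarith
  exact_mod_cast h2

lemma cast_setPair {p q : V} (hpq : p ≠ q) {μ : V → ℕ} {i j : ℕ} (h : i + j = μ p + μ q) :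
    (fun x => (setPair μ p q i j x : ℝ)) = (fun x => (μ x : ℝ)) +
      ((i : ℝ) - μ p) • (Pi.single p 1 - Pi.single q 1 : V → ℝ) := by
  have h' : (i : ℝ) + j = μ p + μ q := by exact_mod_cast h
  funext x
  by_cases hp : x = p
  · subst hp; simp [setPair_left hpq, hpq]
  by_cases hq : x = q
  · subst hq; simp [setPair_right, hp]; linarith
  simp [setPair_of_ne hp hq, hp, hq]

lemma indepSupport_single_sub_single {G : SimpleGraph V} {p q : V} (h : ¬ G.Adj p q) :
    IndepSupport G (Pi.single p 1 - Pi.single q 1) := by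
  have key : ∀ x, (Pi.single p 1 - Pi.single q 1 : V → ℝ) x ≠ 0 → x = p ∨ x = q := by
    intro x hx
    by_contra! hc
    exact hx (by simp [hc.1, hc.2])
  intro x y hx hy
  rcases key x hx with rfl | rfl <;> rcases key y hy with rfl | rfl
  · exact G.irrefl
  · exact h
  · exact fun h' => h h'.symm
  · exact G.irrefl

lemma energy_setPair_of_not_adj (a b : ℝ) {G : SimpleGraph V} {p q : V} (hpq : p ≠ q)
    (hG : ¬ G.Adj p q) {μ : V → ℕ} {i j : ℕ} (h : i + j = μ p + μ q) :
    energy a b G (fun x => (setPair μ p q i j x : ℝ)) = energy a b G (fun x => (μ x : ℝ)) +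
      ((i : ℝ) - μ p) * slope a b G (fun x => (μ x : ℝ)) (Pi.single p 1 - Pi.single q 1) := by
  rw [cast_setPair hpq h, energy_add_smul (indepSupport_single_sub_single hG)]

lemma CliqueSupport.setPair {G : SimpleGraph V} {μ : V → ℕ}
    (hμ : CliqueSupport G fun x => (μ x : ℝ)) {p q : V} (hp : μ p ≠ 0) (hq : μ q ≠ 0) (i j : ℕ) :
    CliqueSupport G fun x => (setPair μ p q i j x : ℝ) := by
  have key : ∀ x, (EdgeTriangle.setPair μ p q i j x : ℝ) ≠ 0 → (μ x : ℝ) ≠ 0 := by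
    intro x hx
    by_cases h1 : x = p
    · subst h1; exact_mod_cast hp
    by_cases h2 : x = q
    · subst h2; exact_mod_cast hq
    rwa [setPair_of_ne h1 h2] at hx
  exact fun x y hx hy => hμ x y (key x hx) (key y hy)

/-- On a clique the energy is a function of the power sums, and with `i + j` fixed both `i² + j²`
and `i³ + j³` are affine in `i * j`. -/
lemma energy_setPair_of_clique (a b : ℝ) {G : SimpleGraph V} {μ : V → ℕ}
    (hμ : CliqueSupport G fun x => (μ x : ℝ)) {p q : V} (hpq : p ≠ q) (hp : μ p ≠ 0)
    (hq : μ q ≠ 0) {i j : ℕ} (h : i + j = μ p + μ q) :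
    energy a b G (fun x => (setPair μ p q i j x : ℝ)) = energy a b G (fun x => (μ x : ℝ)) +
      ((i : ℝ) * j - μ p * μ q) * (2 * a + 6 * b * (∑ x, (μ x : ℝ) - (μ p + μ q))) := by
  have hc := hμ.setPair hp hq i j
  have h' : (j : ℝ) = μ p + μ q - i := by
    have : (i : ℝ) + j = μ p + μ q := by exact_mod_cast h
    linarith
  rw [energy, energy, hc.edgeForm_eq, hc.triForm_eq, hμ.edgeForm_eq, hμ.triForm_eq,
    sum_setPair hpq μ i j fun _ k => (k : ℝ), sum_setPair hpq μ i j fun _ k => (k : ℝ) ^ 2,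
    sum_setPair hpq μ i j fun _ k => (k : ℝ) ^ 3, h']
  ring

/-- The number of vertices of nonzero weight. -/
def suppCard (μ : V → ℕ) : ℕ := (Finset.univ.filter fun x => μ x ≠ 0).card

lemma suppCard_merge_lt {μ : V → ℕ} {p q : V} (hpq : p ≠ q) (hp : μ p ≠ 0) (hq : μ q ≠ 0) (i : ℕ) :
    suppCard (setPair μ p q i 0) < suppCard μ := by
  refine Finset.card_lt_card (Finset.ssubset_iff_of_subset ?_ |>.2 ⟨q, ?_, ?_⟩)
  · intro x hx
    simp only [Finset.mem_filter, Finset.mem_univ, true_and] at hx ⊢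
    by_cases h1 : x = p
    · subst h1; exact hp
    by_cases h2 : x = q
    · subst h2; exact hq
    rwa [setPair_of_ne h1 h2] at hx
  · simpa using hq
  · simp [setPair_right]

lemma suppCard_setPair_le {μ : V → ℕ} {p q : V} (hp : μ p ≠ 0) (hq : μ q ≠ 0)
    (i j : ℕ) : suppCard (setPair μ p q i j) ≤ suppCard μ := by
  refine Finset.card_le_card fun x hx => ?_
  simp only [Finset.mem_filter, Finset.mem_univ, true_and] at hx ⊢
  by_cases h1 : x = p
  · subst h1; exact hp
  by_cases h2 : x = q
  · subst h2; exact hq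
  rwa [setPair_of_ne h1 h2] at hx

lemma setPair_comm {p q : V} (hpq : p ≠ q) (μ : V → ℕ) (i j : ℕ) :
    setPair μ p q i j = setPair μ q p j i := by
  rw [setPair, setPair, Function.update_comm hpq]

/-- Every weight function can be replaced by a balanced one supported on a clique, with the same
total weight and no larger energy. -/
theorem exists_balanced_clique (a b : ℝ) (G : SimpleGraph V) (μ : V → ℕ) :
    ∃ ν : V → ℕ, ∑ x, ν x = ∑ x, μ x ∧
      energy a b G (fun x => (ν x : ℝ)) ≤ energy a b G (fun x => (μ x : ℝ)) ∧
      CliqueSupport G (fun x => (ν x : ℝ)) ∧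
      ∀ p q, ν p ≠ 0 → ν q ≠ 0 → ν p ≤ ν q + 1 := by
  -- Lexicographic measure: a merge lowers the support size; a balancing move does not raise it and
  -- lowers the sum of squares.
  let key : (V → ℕ) → ℕ ×ₗ ℕ := fun ν => toLex (suppCard ν, ∑ x, ν x ^ 2)
  obtain ⟨ν, ⟨hsum, hen⟩, hmin⟩ := (InvImage.wf key (wellFounded_lt)).has_min
    {ν : V → ℕ | ∑ x, ν x = ∑ x, μ x ∧
      energy a b G (fun x => (ν x : ℝ)) ≤ energy a b G (fun x => (μ x : ℝ))} ⟨μ, rfl, le_rfl⟩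
  have hmerge : ∀ p q, p ≠ q → ν p ≠ 0 → ν q ≠ 0 → energy a b G (fun x => (μ x : ℝ)) <
      energy a b G (fun x => (setPair ν p q (ν p + ν q) 0 x : ℝ)) := by
    intro p q hpq hp hq
    by_contra! hc
    refine hmin _ ⟨(sum_setPair_eq hpq (by simp)).trans hsum, hc⟩ ?_
    exact Prod.Lex.toLex_lt_toLex.2 (Or.inl (suppCard_merge_lt hpq hp hq _))
  have hclique : CliqueSupport G (fun x => (ν x : ℝ)) := by
    intro p q hp hq hpq
    replace hp : ν p ≠ 0 := Nat.cast_ne_zero.1 hp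
    replace hq : ν q ≠ 0 := Nat.cast_ne_zero.1 hq
    by_contra hG
    -- The energy is affine along the shift, so the two opposite merges cannot both raise it.
    have h1 := hmerge p q hpq hp hq
    have h2 := hmerge q p hpq.symm hq hp
    rw [← setPair_comm hpq, energy_setPair_of_not_adj a b hpq hG (by ring)] at h2
    rw [energy_setPair_of_not_adj a b hpq hG (by simp)] at h1
    have hp' : (0 : ℝ) < ν p := by exact_mod_cast Nat.pos_of_ne_zero hp
    have hq' : (0 : ℝ) < ν q := by exact_mod_cast Nat.pos_of_ne_zero hq
    push_cast at h1 h2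
    have h3 : 0 < ν q * slope a b G (fun x => (ν x : ℝ)) (Pi.single p 1 - Pi.single q 1) := by
      linarith
    have h4 := pos_of_mul_pos_right h3 hq'.le
    have h5 := mul_pos hp' h4
    linarith
  refine ⟨ν, hsum, hen, hclique, fun p q hp hq => ?_⟩
  by_contra! hlt
  have hpq : p ≠ q := by rintro rfl; omega
  have hp' : (0 : ℝ) < ν p := by exact_mod_cast Nat.pos_of_ne_zero hp
  have hq' : (0 : ℝ) < ν q := by exact_mod_cast Nat.pos_of_ne_zero hq
  have hlt' : (ν q : ℝ) + 1 < ν p := by exact_mod_cast hlt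
  have h1 := hmerge p q hpq hp hq
  rw [energy_setPair_of_clique a b hclique hpq hp hq (by simp)] at h1
  set κ := 2 * a + 6 * b * (∑ x, (ν x : ℝ) - (ν p + ν q)) with hκ
  -- A merge sends the product of the two weights to 0, so it raises the energy only if `κ < 0`.
  -- Moving one unit from the larger to the smaller weight raises the product and hence lowers the
  -- energy.
  have hneg : κ < 0 := by
    by_contra! hc
    have := mul_nonneg (mul_pos hp' hq').le hc
    push_cast at h1
    linarith
  have hcast : ((ν p - 1 : ℕ) : ℝ) = ν p - 1 := by
    rw [Nat.cast_sub (by omega)]; simp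
  have hadd : (ν p - 1) + (ν q + 1) = ν p + ν q := by omega
  refine hmin (setPair ν p q (ν p - 1) (ν q + 1)) ⟨(sum_setPair_eq hpq hadd).trans hsum, ?_⟩ ?_
  · rw [energy_setPair_of_clique a b hclique hpq hp hq hadd, ← hκ, hcast]
    push_cast
    nlinarith
  · have hsq : ∑ x, setPair ν p q (ν p - 1) (ν q + 1) x ^ 2 < ∑ x, ν x ^ 2 := by
      have := sum_setPair hpq ν (ν p - 1) (ν q + 1) fun _ k => (k : ℝ) ^ 2
      rw [hcast] at this
      push_cast at this
      have h' : ∑ x, (setPair ν p q (ν p - 1) (ν q + 1) x : ℝ) ^ 2 < ∑ x, (ν x : ℝ) ^ 2 := by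
        rw [this]; nlinarith
      exact_mod_cast h'
    refine Prod.Lex.toLex_lt_toLex.2 ?_
    rcases (suppCard_setPair_le hp hq (ν p - 1) (ν q + 1)).lt_or_eq with h | h
    · exact Or.inl h
    · exact Or.inr ⟨h, hsq⟩

end Shift

/-! ### Turán graphs -/

section Turan

/-- The residue class of a vertex. -/
def residue (n r : ℕ) [NeZero r] (x : Fin n) : Fin r := Fin.ofNat r x

lemma turanGraph_eq_comap (n r : ℕ) [NeZero r] :
    SimpleGraph.turanGraph n r = (⊤ : SimpleGraph (Fin r)).comap (residue n r) := by
  ext x y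
  simp [SimpleGraph.turanGraph, residue, Fin.ext_iff]

/-- The sizes of the classes of the Turán graph. -/
def classCard (n r : ℕ) [NeZero r] : Fin r → ℕ := fiberCard (residue n r)

lemma classCard_eq (n r : ℕ) [NeZero r] (i : Fin r) :
    classCard n r i = n / r + if (i : ℕ) < n % r then 1 else 0 := by
  have hr : 0 < r := Nat.pos_of_ne_zero (NeZero.ne r)
  have h := Nat.count_modEq_card n hr i
  rw [Nat.mod_eq_of_lt i.2] at h
  rw [← h, Nat.count_eq_card_filter_range, classCard, fiberCard]
  refine Finset.card_bij (fun x _ => (x : ℕ)) ?_ ?_ ?_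
  · intro x hx
    simp only [Finset.mem_filter, Finset.mem_univ, true_and, residue, Fin.ext_iff,
      Fin.val_ofNat] at hx
    simp [Nat.ModEq, hx, Nat.mod_eq_of_lt i.2]
  · intro x _ y _ hxy
    exact Fin.ext hxy
  · intro y hy
    simp only [Finset.mem_filter, Finset.mem_range, Nat.ModEq, Nat.mod_eq_of_lt i.2] at hy
    exact ⟨⟨y, hy.1⟩, by simp [residue, Fin.ext_iff, hy.2], rfl⟩

lemma sum_classCard (n r : ℕ) [NeZero r] : ∑ i, classCard n r i = n := by
  simpa [classCard] using sum_fiberCard (residue n r)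

lemma cliqueSupport_top {W : Type*} (f : W → ℝ) : CliqueSupport ⊤ f :=
  fun _ _ _ _ h => by simpa using h

lemma edgeForm_turanGraph (n r : ℕ) [NeZero r] :
    edgeForm (SimpleGraph.turanGraph n r) 1 1 = (n : ℝ) ^ 2 - ∑ i, (classCard n r i : ℝ) ^ 2 := by
  rw [turanGraph_eq_comap, edgeForm_comap, (cliqueSupport_top _).edgeForm_eq]
  have : ∑ i, (classCard n r i : ℝ) = n := by exact_mod_cast sum_classCard n r
  rw [← this]; rfl

lemma triForm_turanGraph (n r : ℕ) [NeZero r] :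
    triForm (SimpleGraph.turanGraph n r) 1 1 1 = (n : ℝ) ^ 3 -
      3 * n * ∑ i, (classCard n r i : ℝ) ^ 2 + 2 * ∑ i, (classCard n r i : ℝ) ^ 3 := by
  rw [turanGraph_eq_comap, triForm_comap, (cliqueSupport_top _).triForm_eq]
  have : ∑ i, (classCard n r i : ℝ) = n := by exact_mod_cast sum_classCard n r
  rw [← this]; rfl

/-- A sum over two consecutive values is determined by the number of terms and their sum. -/
lemma sum_of_consecutive {ι : Type*} (s : Finset ι) (ν : ι → ℕ) (q : ℕ)
    (h : ∀ i ∈ s, ν i = q ∨ ν i = q + 1) (g : ℕ → ℝ) :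
    ∑ i ∈ s, g (ν i) = s.card * g q + ((∑ i ∈ s, (ν i : ℝ)) - s.card * q) * (g (q + 1) - g q) := by
  have h1 : ∀ i ∈ s, g (ν i) = g q + ((ν i : ℝ) - q) * (g (q + 1) - g q) := by
    intro i hi
    rcases h i hi with h | h <;> rw [h]
    · simp
    · push_cast; ring
  rw [Finset.sum_congr rfl h1, Finset.sum_add_distrib, ← Finset.sum_mul, Finset.sum_sub_distrib]
  simp

lemma sum_classCard_eq_of_consecutive (n r : ℕ) [NeZero r] (q : ℕ)
    (h : ∀ i, classCard n r i = q ∨ classCard n r i = q + 1) (g : ℕ → ℝ) :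
    ∑ i, g (classCard n r i) = r * g q + ((n : ℝ) - r * q) * (g (q + 1) - g q) := by
  have h1 := sum_of_consecutive Finset.univ (classCard n r) q (fun i _ => h i) g
  have : ∑ i, (classCard n r i : ℝ) = n := by exact_mod_cast sum_classCard n r
  rw [this] at h1
  simpa using h1

lemma classCard_consecutive (n r : ℕ) [NeZero r] (i : Fin r) :
    classCard n r i = n / r ∨ classCard n r i = n / r + 1 := by
  rw [classCard_eq]; split_ifs <;> simp

/-- Among all graphs with `n` vertices, the energy is minimized by a Turán graph. -/
theorem exists_turanGraph_energy_le (a b : ℝ) {n : ℕ} (hn : 1 ≤ n) (G : SimpleGraph (Fin n)) :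
    ∃ k < n, energy a b (SimpleGraph.turanGraph n (k + 1)) 1 ≤ energy a b G 1 := by
  obtain ⟨ν, hsum, hen, hcl, hbal⟩ := exists_balanced_clique a b G fun _ => 1
  have hsum' : ∑ x, ν x = n := by simpa using hsum
  set s : Finset (Fin n) := Finset.univ.filter fun x => ν x ≠ 0 with hs
  have hsums : ∑ x ∈ s, ν x = n := by
    exact (Finset.sum_filter_ne_zero _).trans hsum'
  have hne : s.Nonempty := by
    by_contra hc
    rw [Finset.not_nonempty_iff_eq_empty] at hc
    rw [hc, Finset.sum_empty] at hsums
    omega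
  obtain ⟨m, hms, hmin⟩ := s.exists_min_image ν hne
  have hcard : s.card ≤ n := by simpa using Finset.card_le_univ s
  have hpos : 0 < s.card := hne.card_pos
  have hval : ∀ x ∈ s, ν x = ν m ∨ ν x = ν m + 1 := by
    intro x hx
    have h1 := hmin x hx
    have h2 := hbal x m (by simpa [hs] using hx) (by simpa [hs] using hms)
    omega
  have hq : n / s.card = ν m := by
    refine Nat.div_eq_of_lt_le ?_ ?_
    · have := Finset.card_nsmul_le_sum s ν (ν m) hmin
      rw [hsums] at this
      simpa [mul_comm] using this
    · have h : ∑ x ∈ s, ν x < ∑ x ∈ s, (ν m + 1) := by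
        refine Finset.sum_lt_sum (fun x hx => ?_) ⟨m, hms, by omega⟩
        rcases hval x hx with h | h <;> omega
      rw [hsums] at h
      simpa [mul_comm] using h
  obtain ⟨k, hk⟩ : ∃ k, s.card = k + 1 := ⟨s.card - 1, by omega⟩
  -- Both lists have `s.card = k + 1` nonzero-weight entries or classes, values in the same
  -- consecutive pair and total `n`, so their sums agree. The exponent 0 is excluded because
  -- vertices of weight 0 would then count.
  have hpow : ∀ d : ℕ, d ≠ 0 →
      ∑ x, (ν x : ℝ) ^ d = ∑ i, (classCard n (k + 1) i : ℝ) ^ d := by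
    intro d hd
    have h1 : ∑ x, (ν x : ℝ) ^ d = ∑ x ∈ s, (ν x : ℝ) ^ d := by
      rw [hs, Finset.sum_filter]
      refine Finset.sum_congr rfl fun x _ => ?_
      by_cases hx : ν x = 0 <;> simp [hx, hd]
    rw [h1, sum_of_consecutive s ν (ν m) hval fun j => (j : ℝ) ^ d,
      sum_classCard_eq_of_consecutive n (k + 1) (n / (k + 1)) (classCard_consecutive n (k + 1))
        fun j => (j : ℝ) ^ d, ← hk, hq]
    have : ∑ x ∈ s, (ν x : ℝ) = n := by exact_mod_cast hsums
    rw [this]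
  refine ⟨k, by omega, le_trans (le_of_eq ?_) (hen.trans (le_of_eq ?_))⟩
  · have : ∑ x, (ν x : ℝ) = n := by exact_mod_cast hsum'
    rw [energy, energy, edgeForm_turanGraph, triForm_turanGraph, hcl.edgeForm_eq, hcl.triForm_eq,
      hpow 2 two_ne_zero, hpow 3 three_ne_zero, this]
  · congr 1; funext x; simp

end Turan

/-! ### The extremal weights on the edges of the polygon -/

section Chord

variable {V : Type*} [Fintype V] [DecidableEq V]

/-- The affine functional of the edge and triangle counts that vanishes at the complete multipartite
graphs on `n` vertices whose classes all have size `A`, or all have size `B`. -/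
def chordEnergy (n A B : ℕ) (G : SimpleGraph V) (f : V → ℝ) : ℝ :=
  energy (2 * (A + B) - 3 * n) 1 G f -
    ((2 * (A + B) - 3 * n) * n ^ 2 + n ^ 3 - 2 * A * B * n)

/-- The coefficients of `chordEnergy` are chosen so that each class contributes a cubic with roots
`0`, `A` and `B`. -/
lemma chordEnergy_of_clique {n A B : ℕ} {G : SimpleGraph V} {μ : V → ℕ}
    (hμ : CliqueSupport G fun x => (μ x : ℝ)) (hsum : ∑ x, μ x = n) :
    chordEnergy n A B G (fun x => (μ x : ℝ)) =
      2 * ∑ x, (μ x : ℝ) * (((μ x : ℝ) - A) * ((μ x : ℝ) - B)) := by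
  have h1 : ∑ x, (μ x : ℝ) = n := by exact_mod_cast hsum
  have h2 : ∑ x, (μ x : ℝ) * (((μ x : ℝ) - A) * ((μ x : ℝ) - B)) =
      ∑ x, (μ x : ℝ) ^ 3 - (A + B) * ∑ x, (μ x : ℝ) ^ 2 + A * B * ∑ x, (μ x : ℝ) := by
    rw [Finset.mul_sum, Finset.mul_sum, ← Finset.sum_sub_distrib, ← Finset.sum_add_distrib]
    exact Finset.sum_congr rfl fun x _ => by ring
  rw [chordEnergy, energy, hμ.edgeForm_eq, hμ.triForm_eq, h2, h1]
  ring

lemma chordEnergy_setPair_of_clique {n A B : ℕ} {G : SimpleGraph V} {μ : V → ℕ}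
    (hμ : CliqueSupport G fun x => (μ x : ℝ)) (hsum : ∑ x, μ x = n) {p q : V} (hpq : p ≠ q)
    (hp : μ p ≠ 0) (hq : μ q ≠ 0) {i j : ℕ} (h : i + j = μ p + μ q) :
    chordEnergy n A B G (fun x => (setPair μ p q i j x : ℝ)) =
      chordEnergy n A B G (fun x => (μ x : ℝ)) +
      ((i : ℝ) * j - μ p * μ q) * (4 * (A + B) - 6 * (μ p + μ q)) := by
  have h1 : ∑ x, (μ x : ℝ) = n := by exact_mod_cast hsum
  rw [chordEnergy, chordEnergy, energy_setPair_of_clique _ _ hμ hpq hp hq h, h1]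
  ring

/-- Balanced weights of total `r * A = (r + 1) * B` avoid the gap between `B` and `A`. -/
lemma balanced_le_or_ge {n A B r : ℕ} (hA : r * A = n) (hB : (r + 1) * B = n)
    {μ : V → ℕ} (hsum : ∑ x, μ x = n) (hbal : ∀ p q, μ p ≠ 0 → μ q ≠ 0 → μ p ≤ μ q + 1) :
    (∀ x, μ x ≠ 0 → A ≤ μ x) ∨ (∀ x, μ x ≠ 0 → μ x ≤ B) := by
  set s : Finset V := Finset.univ.filter fun x => μ x ≠ 0 with hs
  have hsums : ∑ x ∈ s, μ x = n := (Finset.sum_filter_ne_zero _).trans hsum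
  have mem : ∀ x, x ∈ s ↔ μ x ≠ 0 := fun x => by simp [hs]
  -- With more than `r` classes, one above `B` forces all others to be at least `B`, and the total
  -- exceeds `(r + 1) * B = n`. With at most `r` classes, one below `A` forces all others to be at
  -- most `A`, and the total falls short of `r * A = n`.
  rcases Nat.lt_or_ge r s.card with hr | hr
  · right
    intro x hx
    by_contra! hlt
    have h : ∑ y ∈ s, B < ∑ y ∈ s, μ y := by
      refine Finset.sum_lt_sum (fun y hy => ?_) ⟨x, (mem x).2 hx, hlt⟩
      have := hbal x y hx ((mem y).1 hy)
      omega
    rw [hsums, Finset.sum_const, smul_eq_mul, ← hB] at h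
    exact absurd (Nat.mul_le_mul_right B hr) (not_le.2 h)
  · left
    intro x hx
    by_contra! hlt
    have h : ∑ y ∈ s, μ y < ∑ y ∈ s, A := by
      refine Finset.sum_lt_sum (fun y hy => ?_) ⟨x, (mem x).2 hx, hlt⟩
      have := hbal y x ((mem y).1 hy) hx
      omega
    rw [hsums, Finset.sum_const, smul_eq_mul, ← hA] at h
    exact absurd (Nat.mul_le_mul_right A hr) (not_le.2 h)

lemma mul_gap_nonneg {A B : ℕ} (hBA : B ≤ A) {μ : V → ℕ}
    (h : (∀ x, μ x ≠ 0 → A ≤ μ x) ∨ (∀ x, μ x ≠ 0 → μ x ≤ B)) (x : V) :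
    0 ≤ (μ x : ℝ) * (((μ x : ℝ) - A) * ((μ x : ℝ) - B)) := by
  have hBA' : (B : ℝ) ≤ A := by exact_mod_cast hBA
  by_cases hx : μ x = 0
  · simp [hx]
  refine mul_nonneg (Nat.cast_nonneg _) ?_
  rcases h with h | h
  · have : (A : ℝ) ≤ μ x := by exact_mod_cast h x hx
    exact mul_nonneg (by linarith) (by linarith)
  · have : (μ x : ℝ) ≤ B := by exact_mod_cast h x hx
    exact mul_nonneg_of_nonpos_of_nonpos (by linarith) (by linarith)

/-- Passing to a balanced clique keeps the total and does not raise the energy; there every cubic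
term is nonnegative, since no size lies strictly between `B` and `A`. -/
lemma chordEnergy_nonneg {n A B r : ℕ} (hA : r * A = n) (hB : (r + 1) * B = n) (hBA : B ≤ A)
    (G : SimpleGraph V) {μ : V → ℕ} (hsum : ∑ x, μ x = n) :
    0 ≤ chordEnergy n A B G (fun x => (μ x : ℝ)) := by
  obtain ⟨ν, hν, hen, hcl, hbal⟩ :=
    exists_balanced_clique (2 * ((A : ℝ) + B) - 3 * n) 1 G μ
  have h1 : 0 ≤ chordEnergy n A B G (fun x => (ν x : ℝ)) := by
    rw [chordEnergy_of_clique hcl (hν.trans hsum)]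
    exact mul_nonneg zero_le_two (Finset.sum_nonneg fun x _ =>
      mul_gap_nonneg hBA (balanced_le_or_ge hA hB (hν.trans hsum) hbal) x)
  rw [chordEnergy] at h1 ⊢
  linarith

/-- At a minimizer, the chord energy is stationary under shifts between nonadjacent vertices. -/
lemma slope_eq_zero_of_chordEnergy_eq_zero {n A B r : ℕ} (hA : r * A = n)
    (hB : (r + 1) * B = n) (hBA : B ≤ A) {G : SimpleGraph V} {μ : V → ℕ} (hsum : ∑ x, μ x = n)
    (h0 : chordEnergy n A B G (fun x => (μ x : ℝ)) = 0) {p q : V} (hpq : p ≠ q)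
    (hG : ¬ G.Adj p q) (hp : μ p ≠ 0) (hq : μ q ≠ 0) :
    slope (2 * (A + B) - 3 * n) 1 G (fun x => (μ x : ℝ)) (Pi.single p 1 - Pi.single q 1) = 0 := by
  -- The merges into `p` and into `q` change the energy by the slope times `μ q` and times `-μ p`;
  -- both changes must be nonnegative.
  have h1 := chordEnergy_nonneg hA hB hBA G
    ((sum_setPair_eq hpq (i := μ p + μ q) (j := 0) (by simp)).trans hsum)
  have h2 := chordEnergy_nonneg hA hB hBA G
    ((sum_setPair_eq hpq (i := 0) (j := μ p + μ q) (by simp)).trans hsum)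
  rw [chordEnergy, energy_setPair_of_not_adj _ _ hpq hG (by simp)] at h1 h2
  rw [chordEnergy] at h0
  have hp' : (0 : ℝ) < μ p := by exact_mod_cast Nat.pos_of_ne_zero hp
  have hq' : (0 : ℝ) < μ q := by exact_mod_cast Nat.pos_of_ne_zero hq
  push_cast at h1 h2
  refine le_antisymm ?_ ?_
  · refine le_of_mul_le_mul_left ?_ hp'
    linarith
  · refine le_of_mul_le_mul_left ?_ hq'
    linarith

/-- The weighted number of common neighbours. -/
def codeg (G : SimpleGraph V) (f : V → ℝ) (u w : V) : ℝ := ∑ x, f x * (adj G x u * adj G x w)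

lemma codeg_of_clique {G : SimpleGraph V} {f : V → ℝ} (hf : CliqueSupport G f) {u w : V}
    (hu : f u ≠ 0) (hw : f w ≠ 0) (huw : u ≠ w) : codeg G f u w = ∑ x, f x - (f u + f w) := by
  have h : ∀ x, f x * (adj G x u * adj G x w) =
      f x - ((if x = u then f u else 0) + if x = w then f w else 0) := by
    intro x
    by_cases h1 : x = u
    · subst h1; simp [adj_self, huw]
    by_cases h2 : x = w
    · subst h2; simp [adj_self, h1]
    by_cases h3 : f x = 0
    · simp [h3, h1, h2]
    simp [adj_of_adj (hf x u h3 hu h1), adj_of_adj (hf x w h3 hw h2), h1, h2]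
  simp [codeg, h, Finset.sum_sub_distrib, Finset.sum_add_distrib]

lemma codeg_setPair {G : SimpleGraph V} {μ : V → ℕ} {p q : V} (hpq : p ≠ q) (u w : V) (i j : ℕ) :
    codeg G (fun x => (setPair μ p q i j x : ℝ)) u w = codeg G (fun x => (μ x : ℝ)) u w +
      ((i : ℝ) - μ p) * (adj G p u * adj G p w) + ((j : ℝ) - μ q) * (adj G q u * adj G q w) := by
  rw [codeg, sum_setPair hpq μ i j fun x k => (k : ℝ) * (adj G x u * adj G x w), codeg]
  ring

lemma adj_nonneg (G : SimpleGraph V) (x y : V) : 0 ≤ adj G x y := by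
  unfold adj; split_ifs <;> simp

/-- Any two classes of a minimizer supported on a clique have joint size greater than
`2 (A + B) / 3`: otherwise they could be merged. -/
lemma two_mul_add_lt_of_clique {n A B r : ℕ} (hA : r * A = n) (hB : (r + 1) * B = n)
    (hBA : B ≤ A) (hAB : A < 2 * B) {G : SimpleGraph V} {μ : V → ℕ}
    (hμ : CliqueSupport G fun x => (μ x : ℝ)) (hsum : ∑ x, μ x = n)
    (h0 : chordEnergy n A B G (fun x => (μ x : ℝ)) = 0) {u w : V} (huw : u ≠ w)
    (hu : μ u ≠ 0) (hw : μ w ≠ 0) : 2 * (A + B) < 3 * (μ u + μ w) := by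
  by_contra! hle
  have hle' : 3 * ((μ u : ℝ) + μ w) ≤ 2 * (A + B) := by exact_mod_cast hle
  have hu' : (0 : ℝ) < μ u := by exact_mod_cast Nat.pos_of_ne_zero hu
  have hw' : (0 : ℝ) < μ w := by exact_mod_cast Nat.pos_of_ne_zero hw
  set ν := setPair μ u w (μ u + μ w) 0 with hν
  have hνsum : ∑ x, ν x = n := (sum_setPair_eq huw (by simp)).trans hsum
  have hνcl : CliqueSupport G (fun x => (ν x : ℝ)) := hμ.setPair hu hw _ _
  have h1 := chordEnergy_nonneg hA hB hBA G hνsum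
  have h2 : chordEnergy n A B G (fun x => (ν x : ℝ)) =
      - (μ u * μ w * (4 * (A + B) - 6 * (μ u + μ w))) := by
    rw [hν, chordEnergy_setPair_of_clique hμ hsum huw hu hw (by simp), h0]
    push_cast; ring
  have hprod := mul_pos hu' hw'
  -- If the joint size is at most `2 (A + B) / 3`, merging does not raise the chord energy;
  -- nonnegativity then forces equality, and the merged weights again have chord energy 0.
  have hκ : 4 * ((A : ℝ) + B) - 6 * (μ u + μ w) = 0 := by
    refine le_antisymm ?_ (by linarith)
    refine le_of_mul_le_mul_left ?_ hprod
    linarith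
  rw [hκ, mul_zero, neg_zero] at h2
  have hs : ν u = μ u + μ w := setPair_left huw _ _ _
  have hs3 : 3 * (μ u + μ w) = 2 * (A + B) := by
    have : 3 * ((μ u : ℝ) + μ w) = 2 * (A + B) := by linarith
    exact_mod_cast this
  have hνu : ν u ≠ 0 := by omega
  -- The merged class has size `2 (A + B) / 3`, which exceeds `A` exactly because `A < 2 * B`.
  have hgt : A < ν u := by omega
  -- A smaller class could receive one unit from `u`, changing the chord energy by `-6 * ν x * (ν u
  -- - ν x - 1) < 0`. Once all classes are at least `A`, the term of `u` makes the cubic sum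
  -- positive.
  have hge : ∀ x, ν x ≠ 0 → A ≤ ν x := by
    intro x hx
    by_cases hxu : u = x
    · subst hxu; exact hgt.le
    by_contra! hlt
    have hadd : (ν u - 1) + (ν x + 1) = ν u + ν x := by omega
    have h3 := chordEnergy_nonneg hA hB hBA G ((sum_setPair_eq hxu hadd).trans hνsum)
    rw [chordEnergy_setPair_of_clique hνcl hνsum hxu hνu hx hadd, h2,
      Nat.cast_sub (by omega : 1 ≤ ν u)] at h3
    have h4 : (ν x : ℝ) + 1 < ν u := by exact_mod_cast (by omega : ν x + 1 < ν u)
    have h5 : (0 : ℝ) < ν x := by exact_mod_cast Nat.pos_of_ne_zero hx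
    have h6 : 3 * (ν u : ℝ) = 2 * (A + B) := by
      have : 3 * ν u = 2 * (A + B) := by omega
      exact_mod_cast this
    have h7 : 4 * ((A : ℝ) + B) - 6 * (ν u + ν x) = - (6 * ν x) := by linarith
    rw [h7] at h3
    push_cast at h3
    have h8 := mul_pos (sub_pos.2 h4) h5
    nlinarith
  rw [chordEnergy_of_clique hνcl hνsum] at h2
  have hpos : 0 < ∑ x, (ν x : ℝ) * (((ν x : ℝ) - A) * ((ν x : ℝ) - B)) := by
    refine Finset.sum_pos' (fun x _ => mul_gap_nonneg hBA (Or.inl hge) x)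
      ⟨u, Finset.mem_univ _, ?_⟩
    have hgt' : (A : ℝ) < ν u := by exact_mod_cast hgt
    have hBA' : (B : ℝ) ≤ A := by exact_mod_cast hBA
    have : (0 : ℝ) ≤ A := Nat.cast_nonneg _
    exact mul_pos (by linarith) (mul_pos (by linarith) (by linarith))
  linarith

/-- At a minimizer every edge has few common neighbours. -/
lemma codeg_lt {n A B r : ℕ} (hA : r * A = n) (hB : (r + 1) * B = n)
    (hBA : B ≤ A) (hAB : A < 2 * B) {G : SimpleGraph V} {μ : V → ℕ} (hsum : ∑ x, μ x = n)
    (h0 : chordEnergy n A B G (fun x => (μ x : ℝ)) = 0) {u w : V} (huw : G.Adj u w)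
    (hu : μ u ≠ 0) (hw : μ w ≠ 0) :
    3 * codeg G (fun x => (μ x : ℝ)) u w < 3 * n - 2 * (A + B) := by
  by_contra! hcod
  -- Among the counterexamples keeping `u` and `w` in the support, take one of smallest support.
  -- Since slopes vanish, nonadjacent vertices can be merged at no cost, into the one contributing
  -- more to the codegree; so the support is a clique and the codegree is `n - ν u - ν w`.
  obtain ⟨ν, ⟨hνsum, hν0, hνu, hνw, hνc⟩, hmin⟩ :=
    (InvImage.wf (suppCard (V := V)) wellFounded_lt).has_min
    {ν : V → ℕ | ∑ x, ν x = n ∧ chordEnergy n A B G (fun x => (ν x : ℝ)) = 0 ∧ ν u ≠ 0 ∧ ν w ≠ 0 ∧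
      3 * (n : ℝ) - 2 * (A + B) ≤ 3 * codeg G (fun x => (ν x : ℝ)) u w} ⟨μ, hsum, h0, hu, hw, hcod⟩
  have step : ∀ p q, p ≠ q → ¬ G.Adj p q → ν p ≠ 0 → ν q ≠ 0 → q ≠ u → q ≠ w →
      adj G q u * adj G q w ≤ adj G p u * adj G p w → False := by
    intro p q hpq hG hp hq hqu hqw hle
    refine hmin (setPair ν p q (ν p + ν q) 0) ⟨(sum_setPair_eq hpq (by simp)).trans hνsum, ?_, ?_,
      ?_, ?_⟩ (suppCard_merge_lt hpq hp hq _)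
    · rw [chordEnergy, energy_setPair_of_not_adj _ _ hpq hG (by simp),
        slope_eq_zero_of_chordEnergy_eq_zero hA hB hBA hνsum hν0 hpq hG hp hq, mul_zero, add_zero]
      exact hν0
    · by_cases h : u = p
      · subst h; rw [setPair_left hpq]; omega
      · rwa [setPair_of_ne h hqu.symm]
    · by_cases h : w = p
      · subst h; rw [setPair_left hpq]; omega
      · rwa [setPair_of_ne h hqw.symm]
    · rw [codeg_setPair hpq]
      have hq' : (0 : ℝ) ≤ ν q := Nat.cast_nonneg _
      have := mul_le_mul_of_nonneg_left hle hq'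
      push_cast
      linarith
  -- A vertex nonadjacent to `u` or to `w` is no common neighbour, so absorbing it into `u` or `w`
  -- loses no codegree.
  have zero : ∀ p q, ¬ G.Adj p q → p = u ∨ p = w → adj G q u * adj G q w = 0 := by
    rintro p q h (rfl | rfl)
    · rw [adj_of_not_adj fun h' => h h'.symm, zero_mul]
    · rw [adj_of_not_adj (x := q) fun h' => h h'.symm, mul_zero]
  have hne : ∀ p q, p ≠ q → ¬ G.Adj p q → p = u ∨ p = w → q ≠ u ∧ q ≠ w := by
    rintro p q hpq h (rfl | rfl)
    · exact ⟨hpq.symm, fun h' => h (h' ▸ huw)⟩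
    · exact ⟨fun h' => h (h' ▸ huw.symm), hpq.symm⟩
  have hnn : ∀ p, 0 ≤ adj G p u * adj G p w := fun p =>
    mul_nonneg (adj_nonneg ..) (adj_nonneg ..)
  have hcl : CliqueSupport G (fun x => (ν x : ℝ)) := by
    intro p q hp hq hpq
    replace hp : ν p ≠ 0 := Nat.cast_ne_zero.1 hp
    replace hq : ν q ≠ 0 := Nat.cast_ne_zero.1 hq
    by_contra hG
    have hG' : ¬ G.Adj q p := fun h => hG h.symm
    by_cases hpu : p = u ∨ p = w
    · obtain ⟨h1, h2⟩ := hne p q hpq hG hpu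
      exact step p q hpq hG hp hq h1 h2 (by rw [zero p q hG hpu]; exact hnn p)
    by_cases hqu : q = u ∨ q = w
    · obtain ⟨h1, h2⟩ := hne q p hpq.symm hG' hqu
      exact step q p hpq.symm hG' hq hp h1 h2 (by rw [zero q p hG' hqu]; exact hnn q)
    push Not at hpu hqu
    rcases le_total (adj G q u * adj G q w) (adj G p u * adj G p w) with h | h
    · exact step p q hpq hG hp hq hqu.1 hqu.2 h
    · exact step q p hpq.symm hG' hq hp hpu.1 hpu.2 h
  have hs := two_mul_add_lt_of_clique hA hB hBA hAB hcl hνsum hν0 huw.ne hνu hνw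
  have hs' : 2 * ((A : ℝ) + B) < 3 * (ν u + ν w) := by exact_mod_cast hs
  rw [codeg_of_clique hcl (Nat.cast_ne_zero.2 hνu) (Nat.cast_ne_zero.2 hνw) huw.ne] at hνc
  have h1 : ∑ x, (ν x : ℝ) = n := by exact_mod_cast hνsum
  rw [h1] at hνc
  linarith

/-- At a minimizer nonadjacency is transitive. -/
lemma not_adj_trans_of_chordEnergy_eq_zero {n A B r : ℕ} (hA : r * A = n) (hB : (r + 1) * B = n)
    (hBA : B ≤ A) (hAB : A < 2 * B) {G : SimpleGraph V} (hn : Fintype.card V = n)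
    (h0 : chordEnergy n A B G 1 = 0) {u v w : V} (huv : ¬ G.Adj u v) (hvw : ¬ G.Adj v w) :
    ¬ G.Adj u w := by
  intro huw
  have hone : (1 : V → ℝ) = fun x => (((fun _ => 1 : V → ℕ) x : ℕ) : ℝ) := by funext; simp
  have hsum : ∑ x, (fun _ => 1 : V → ℕ) x = n := by simpa using hn
  have hvu : v ≠ u := by rintro rfl; exact hvw huw
  have hvw' : v ≠ w := by rintro rfl; exact huv huw
  have hvu' : ¬ G.Adj v u := fun h => huv h.symm
  have hcod := codeg_lt hA hB hBA hAB hsum (hone ▸ h0) huw one_ne_zero one_ne_zero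
  have s1 := slope_eq_zero_of_chordEnergy_eq_zero hA hB hBA hsum (hone ▸ h0) hvu hvu'
    one_ne_zero one_ne_zero
  have s2 := slope_eq_zero_of_chordEnergy_eq_zero hA hB hBA hsum (hone ▸ h0) hvw' hvw
    one_ne_zero one_ne_zero
  rw [← hone] at hcod s1 s2
  set e : V → ℝ := Pi.single v 1 - Pi.single u 1 with he
  set e' : V → ℝ := Pi.single v 1 - Pi.single w 1 with he'
  -- Move the weights of both `u` and `w` onto `v`. Each shift alone is free to first order and
  -- exactly affine, so only the interaction of the two matters.
  let ν : V → ℕ := setPair (setPair (fun _ => 1) v u 2 0) v w 3 0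
  have hνsum : ∑ x, ν x = n := by
    rw [sum_setPair_eq hvw' ?_, sum_setPair_eq hvu (by simp), hsum]
    rw [setPair_left hvu, setPair_of_ne hvw'.symm huw.ne.symm]
  have hν : (fun x => (ν x : ℝ)) = 1 + e + e' := by
    have h1 := cast_setPair hvu (μ := fun _ => 1) (i := 2) (j := 0) (by simp)
    have h2 := cast_setPair hvw' (μ := setPair (fun _ => 1) v u 2 0) (i := 3) (j := 0)
      (by rw [setPair_left hvu, setPair_of_ne hvw'.symm huw.ne.symm])
    rw [h2, h1, setPair_left hvu, hone, he, he']
    norm_num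
  have hnn := chordEnergy_nonneg hA hB hBA G hνsum
  rw [hν, chordEnergy, energy_add_add (indepSupport_single_sub_single hvu')
    (indepSupport_single_sub_single hvw), s1, s2] at hnn
  have hE : edgeForm G e e' = 1 := by
    have : ∀ x, ∑ y, e x * e' y * adj G x y = e x * (adj G x v - adj G x w) := by
      intro x
      simp [he', mul_assoc, ← Finset.mul_sum, sub_mul, Finset.sum_sub_distrib, Pi.single_apply]
    rw [edgeForm, Finset.sum_congr rfl fun x _ => this x]
    simp [he, sub_mul, Finset.sum_sub_distrib, Pi.single_apply, adj_self, adj_of_not_adj hvw,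
      adj_of_not_adj huv, adj_of_adj huw]
  have hT : triForm G 1 e e' = codeg G 1 u w := by
    rw [triForm, codeg]
    refine Finset.sum_congr rfl fun x _ => ?_
    have : ∀ y, ∑ z, (1 : V → ℝ) x * e y * e' z * (adj G x y * adj G y z * adj G x z) =
        e y * (adj G x y * adj G y v * adj G x v - adj G x y * adj G y w * adj G x w) := by
      intro y
      simp [he', mul_assoc, ← Finset.mul_sum, sub_mul, Finset.sum_sub_distrib, Pi.single_apply]
    rw [Finset.sum_congr rfl fun y _ => this y]
    simp [he, sub_mul, Finset.sum_sub_distrib, Pi.single_apply, adj_self, adj_of_not_adj hvw,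
      adj_of_not_adj huv, adj_of_adj huw]
  -- The total change is `2 * (2 * (A + B) - 3 * n) + 6 * codeg G 1 u w`, which `codeg_lt` makes
  -- negative.
  rw [hE, hT] at hnn
  rw [chordEnergy] at h0
  linarith

/-- A graph of vanishing chord energy has the edge and triangle counts of a complete multipartite
graph with all classes of size `A` or all classes of size `B`. -/
theorem forms_of_chordEnergy_eq_zero {n A B r : ℕ} (hA : r * A = n) (hB : (r + 1) * B = n)
    (hBA : B < A) (hAB : A < 2 * B) {G : SimpleGraph V} (hn : Fintype.card V = n)
    (h0 : chordEnergy n A B G 1 = 0) :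
    ∃ C, (C = A ∨ C = B) ∧ edgeForm G 1 1 = (n : ℝ) ^ 2 - C * n ∧
      triForm G 1 1 1 = (n : ℝ) ^ 3 - 3 * C * n ^ 2 + 2 * C ^ 2 * n := by
  classical
  -- The classes of nonadjacency exhibit `G` as complete multipartite. With `c` choosing
  -- representatives, `G` is its own blow-up along `c`, so its counts are those of the class sizes
  -- placed on a clique of representatives.
  let S : Setoid V := ⟨fun x y => ¬ G.Adj x y, fun _ => G.irrefl, fun h h' => h h'.symm,
    fun h h' => not_adj_trans_of_chordEnergy_eq_zero hA hB hBA.le hAB hn h0 h h'⟩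
  let c : V → V := fun x => (Quotient.mk S x).out
  have hc : ∀ x, ¬ G.Adj (c x) x := fun x => Quotient.mk_out (s := S) x
  have hcc : ∀ x y, ¬ G.Adj x y → c x = c y := fun x y h =>
    congrArg Quotient.out (Quotient.sound (s := S) h)
  have hcomap : G.comap c = G := by
    ext x y
    rw [SimpleGraph.comap_adj, ← not_iff_not]
    constructor
    · intro h
      exact S.trans (S.symm (hc x)) (S.trans h (hc y))
    · intro h
      exact S.trans (hc x) (S.trans h (S.symm (hc y)))
  set μ : V → ℕ := fiberCard c with hμ
  have hsum : ∑ x, μ x = n := (sum_fiberCard c).trans hn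
  have hrange : ∀ x, μ x ≠ 0 → ∃ y, c y = x := by
    intro x hx
    obtain ⟨y, hy⟩ := Finset.card_pos.1 (Nat.pos_of_ne_zero hx)
    exact ⟨y, (Finset.mem_filter.1 hy).2⟩
  have hcl : CliqueSupport G (fun x => (μ x : ℝ)) := by
    intro x y hx hy hxy
    by_contra hG
    obtain ⟨x', rfl⟩ := hrange x (Nat.cast_ne_zero.1 hx)
    obtain ⟨y', rfl⟩ := hrange y (Nat.cast_ne_zero.1 hy)
    exact hxy (hcc _ _ (S.trans (S.symm (hc x')) (S.trans hG (hc y'))))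
  have hE : edgeForm G 1 1 = edgeForm G (fun x => (μ x : ℝ)) (fun x => (μ x : ℝ)) := by
    rw [hμ, ← edgeForm_comap c G, hcomap]
  have hT : triForm G 1 1 1 =
      triForm G (fun x => (μ x : ℝ)) (fun x => (μ x : ℝ)) (fun x => (μ x : ℝ)) := by
    rw [hμ, ← triForm_comap c G, hcomap]
  have hμ0 : chordEnergy n A B G (fun x => (μ x : ℝ)) = 0 := by
    rw [← h0, chordEnergy, chordEnergy, energy, energy, hE, hT]
  -- If two sizes differed by more than 1, moving a unit would raise their product, while
  -- `two_mul_add_lt_of_clique` makes its coefficient negative; the chord energy would drop below 0.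
  have hbal : ∀ p q, μ p ≠ 0 → μ q ≠ 0 → μ p ≤ μ q + 1 := by
    intro p q hp hq
    by_contra! hlt
    have hpq : p ≠ q := by rintro rfl; omega
    have hadd : (μ p - 1) + (μ q + 1) = μ p + μ q := by omega
    have h1 := chordEnergy_nonneg hA hB hBA.le G ((sum_setPair_eq hpq hadd).trans hsum)
    rw [chordEnergy_setPair_of_clique hcl hsum hpq hp hq hadd, hμ0,
      Nat.cast_sub (by omega : 1 ≤ μ p)] at h1
    have h2 : 2 * ((A : ℝ) + B) < 3 * (μ p + μ q) := by
      exact_mod_cast two_mul_add_lt_of_clique hA hB hBA.le hAB hcl hsum hμ0 hpq hp hq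
    have h3 : (μ q : ℝ) + 1 < μ p := by exact_mod_cast hlt
    push_cast at h1
    have h4 := mul_pos (sub_pos.2 h3) (sub_pos.2 h2)
    nlinarith
  have hor := balanced_le_or_ge hA hB hsum hbal
  have hzero : ∀ x, (μ x : ℝ) * (((μ x : ℝ) - A) * ((μ x : ℝ) - B)) = 0 := by
    rw [chordEnergy_of_clique hcl hsum] at hμ0
    have h1 := (Finset.sum_eq_zero_iff_of_nonneg fun x _ =>
      mul_gap_nonneg hBA.le hor x).1 (by linarith)
    exact fun x => h1 x (Finset.mem_univ x)
  have hBA' : (B : ℝ) < A := by exact_mod_cast hBA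
  obtain ⟨C, hC, hCx⟩ : ∃ C, (C = A ∨ C = B) ∧ ∀ x, μ x ≠ 0 → (μ x : ℝ) = C := by
    rcases hor with h | h
    · refine ⟨A, Or.inl rfl, fun x hx => ?_⟩
      have h1 : (A : ℝ) ≤ μ x := by exact_mod_cast h x hx
      rcases mul_eq_zero.1 (hzero x) with h2 | h2
      · exact absurd (Nat.cast_eq_zero.1 h2) hx
      rcases mul_eq_zero.1 h2 with h3 | h3 <;> linarith
    · refine ⟨B, Or.inr rfl, fun x hx => ?_⟩
      have h1 : (μ x : ℝ) ≤ B := by exact_mod_cast h x hx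
      rcases mul_eq_zero.1 (hzero x) with h2 | h2
      · exact absurd (Nat.cast_eq_zero.1 h2) hx
      rcases mul_eq_zero.1 h2 with h3 | h3 <;> linarith
  have h1 : ∑ x, (μ x : ℝ) = n := by exact_mod_cast hsum
  have h2 : ∑ x, (μ x : ℝ) ^ 2 = C * n := by
    rw [← h1, Finset.mul_sum]
    refine Finset.sum_congr rfl fun x _ => ?_
    by_cases hx : μ x = 0
    · simp [hx]
    · rw [hCx x hx]; ring
  have h3 : ∑ x, (μ x : ℝ) ^ 3 = C ^ 2 * n := by
    rw [← h1, Finset.mul_sum]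
    refine Finset.sum_congr rfl fun x _ => ?_
    by_cases hx : μ x = 0
    · simp [hx]
    · rw [hCx x hx]; ring
  refine ⟨C, hC, ?_, ?_⟩
  · rw [hE, hcl.edgeForm_eq, h1, h2]
  · rw [hT, hcl.triForm_eq, h1, h2, h3]; ring

end Chord

/-! ### Density vectors of graphs -/

section Density

open Classical in
/-- The indicator of the edge set of a graph. -/
def edgeInd {V : Type*} (G : SimpleGraph V) (e : Sym2 V) : ℝ := if e ∈ G.edgeSet then 1 else 0

lemma edgeInd_mk {n : ℕ} (G : SimpleGraph (Fin n)) (x y : Fin n) :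
    edgeInd G s(x, y) = adj G x y := by
  classical
  unfold edgeInd adj
  exact if_congr (SimpleGraph.mem_edgeSet G) rfl rfl

/-- Homomorphisms are counted by products of edge indicators. -/
lemma card_hom_eq_sum {m n : ℕ} (H : SimpleGraph (Fin m)) [DecidableRel H.Adj]
    (G : SimpleGraph (Fin n)) :
    (Nat.card (H →g G) : ℝ) = ∑ g : Fin m → Fin n, ∏ e ∈ H.edgeFinset, edgeInd G (e.map g) := by
  classical
  have h1 : ∀ g : Fin m → Fin n, ∏ e ∈ H.edgeFinset, edgeInd G (e.map g) =
      if ∀ x y, H.Adj x y → G.Adj (g x) (g y) then 1 else 0 := by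
    intro g
    unfold edgeInd
    rw [Finset.prod_boole]
    have hiff : (∀ e ∈ H.edgeFinset, e.map g ∈ G.edgeSet) ↔
        ∀ x y, H.Adj x y → G.Adj (g x) (g y) := by
      refine ⟨fun h x y hxy => ?_, fun h e he => ?_⟩
      · simpa using h s(x, y) (by simpa using hxy)
      · induction e with
        | h x y => simpa using h x y (by simpa using he)
    by_cases hp : ∀ x y, H.Adj x y → G.Adj (g x) (g y)
    · rw [if_pos (hiff.2 hp), if_pos hp]
    · rw [if_neg fun h => hp (hiff.1 h), if_neg hp]
  rw [Finset.sum_congr rfl fun g _ => h1 g, Finset.sum_boole, Nat.cast_inj,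
    ← Fintype.card_subtype, ← Nat.card_eq_fintype_card]
  exact Nat.card_congr
    { toFun := fun f => ⟨f, fun _ _ h => f.map_adj h⟩
      invFun := fun g => ⟨g.1, fun h => g.2 _ _ h⟩
      left_inv := fun _ => rfl
      right_inv := fun _ => rfl }

lemma edgeFinset_top_fin_two : (⊤ : SimpleGraph (Fin 2)).edgeFinset = {s(0, 1)} := by decide

lemma edgeFinset_top_fin_three :
    (⊤ : SimpleGraph (Fin 3)).edgeFinset = {s(0, 1), s(1, 2), s(0, 2)} := by decide

/-- Triples as functions on `Fin 3`. -/
def tripleEquiv (V : Type*) : V × V × V ≃ (Fin 3 → V) where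
  toFun p := ![p.1, p.2.1, p.2.2]
  invFun g := (g 0, g 1, g 2)
  left_inv _ := rfl
  right_inv g := by ext i; fin_cases i <;> rfl

lemma homDensity_two {n : ℕ} (G : SimpleGraph (Fin n)) :
    homDensity (⊤ : SimpleGraph (Fin 2)) G = edgeForm G 1 1 / (n : ℝ) ^ 2 := by
  rw [homDensity, card_hom_eq_sum, edgeFinset_top_fin_two,
    ← Equiv.sum_comp (finTwoArrowEquiv (Fin n)).symm, Fintype.sum_prod_type]
  simp [edgeForm, edgeInd_mk]

lemma homDensity_three {n : ℕ} (G : SimpleGraph (Fin n)) :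
    homDensity (⊤ : SimpleGraph (Fin 3)) G = triForm G 1 1 1 / (n : ℝ) ^ 3 := by
  rw [homDensity, card_hom_eq_sum, edgeFinset_top_fin_three,
    ← Equiv.sum_comp (tripleEquiv (Fin n)), Fintype.sum_prod_type]
  simp only [Fintype.sum_prod_type]
  congr 1
  refine Finset.sum_congr rfl fun x _ => Finset.sum_congr rfl fun y _ =>
    Finset.sum_congr rfl fun z _ => ?_
  rw [Finset.prod_insert (by decide), Finset.prod_insert (by decide), Finset.prod_singleton]
  change edgeInd G s(x, y) * (edgeInd G s(y, z) * edgeInd G s(x, z)) = _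
  simp [edgeInd_mk, mul_assoc]

lemma tGraph_eq {n : ℕ} (G : SimpleGraph (Fin n)) :
    tGraph G = !₂[edgeForm G 1 1 / (n : ℝ) ^ 2, triForm G 1 1 1 / (n : ℝ) ^ 3] := by
  rw [tGraph, homDensity_two, homDensity_three]

/-- The `d`-th power sum of the relative class sizes of a Turán graph. -/
def classSum (n r d : ℕ) [NeZero r] : ℝ := ∑ i, ((classCard n r i : ℝ) / n) ^ d

lemma vn_eq {n : ℕ} (hn : 1 ≤ n) (k : ℕ) :
    vn k n = !₂[1 - classSum n (k + 1) 2,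
      1 - 3 * classSum n (k + 1) 2 + 2 * classSum n (k + 1) 3] := by
  have hn' : (n : ℝ) ≠ 0 := by exact_mod_cast (by omega : n ≠ 0)
  rw [vn, tGraph_eq, edgeForm_turanGraph, triForm_turanGraph]
  simp only [classSum, div_pow, ← Finset.sum_div]
  congr 2
  · field_simp
  · congr 1
    field_simp

lemma classSum_of_consecutive {n : ℕ} (k q : ℕ)
    (h : ∀ i, classCard n (k + 1) i = q ∨ classCard n (k + 1) i = q + 1) (d : ℕ) :
    classSum n (k + 1) d = ((k + 1) * (q : ℝ) ^ d +
      ((n : ℝ) - (k + 1) * q) * (((q : ℝ) + 1) ^ d - (q : ℝ) ^ d)) / n ^ d := by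
  have := sum_classCard_eq_of_consecutive n (k + 1) q h fun j => (j : ℝ) ^ d
  push_cast at this
  simp only [classSum, div_pow, ← Finset.sum_div, this]

/-! ### The vertices of the polygon of density vectors. -/

lemma euclidean_two_ext {x y : EuclideanSpace ℝ (Fin 2)} (h0 : x 0 = y 0) (h1 : x 1 = y 1) :
    x = y := by
  ext i
  fin_cases i
  · exact h0
  · exact h1

/-- The linear form `x ↦ f x` in coordinates. -/
lemma clm_euclidean_two (f : EuclideanSpace ℝ (Fin 2) →L[ℝ] ℝ) (s t : ℝ) :
    f !₂[s, t] = s * f !₂[1, 0] + t * f !₂[0, 1] := by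
  have : (!₂[s, t] : EuclideanSpace ℝ (Fin 2)) = s • !₂[1, 0] + t • !₂[0, 1] := by
    apply euclidean_two_ext <;> simp
  rw [this, map_add, map_smul, map_smul, smul_eq_mul, smul_eq_mul]

/-- The vertices of the polygon of density vectors. -/
def vertexSet (n : ℕ) : Set (EuclideanSpace ℝ (Fin 2)) :=
  {x | ∃ k : ℕ, k < ⌈(n : ℝ) / 2⌉₊ ∧ x = vn k n} ∪ {vn (n - 1) n}

lemma ceil_half (n : ℕ) : ⌈(n : ℝ) / 2⌉₊ = (n + 1) / 2 := by
  refine le_antisymm (Nat.ceil_le.2 ?_) ?_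
  · have : n ≤ 2 * ((n + 1) / 2) := by omega
    have : (n : ℝ) ≤ 2 * (((n + 1) / 2 : ℕ) : ℝ) := by exact_mod_cast this
    linarith
  · have h := Nat.le_ceil ((n : ℝ) / 2)
    have : (n : ℝ) ≤ 2 * (⌈(n : ℝ) / 2⌉₊ : ℝ) := by linarith
    have : n ≤ 2 * ⌈(n : ℝ) / 2⌉₊ := by exact_mod_cast this
    omega

lemma finite_vertexSet (n : ℕ) : (vertexSet n).Finite := by
  refine Set.Finite.union ?_ (Set.finite_singleton _)
  refine ((Set.finite_lt_nat ⌈(n : ℝ) / 2⌉₊).image fun k => vn k n).subset ?_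
  rintro x ⟨k, hk, rfl⟩
  exact ⟨k, hk, rfl⟩

/-- The density vector of a Turán graph with classes of sizes one and two only. -/
lemma vn_of_le_two_mul {n k : ℕ} (hk : k < n) (hn : n ≤ 2 * (k + 1)) :
    vn k n = !₂[1 - (3 * n - 2 * (k + 1)) / (n : ℝ) ^ 2,
      1 - 3 * ((3 * n - 2 * (k + 1)) / (n : ℝ) ^ 2) +
        2 * ((7 * n - 6 * (k + 1)) / (n : ℝ) ^ 3)] := by
  have h : ∀ i, classCard n (k + 1) i = 1 ∨ classCard n (k + 1) i = 1 + 1 := by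
    intro i
    rw [classCard_eq]
    rcases hn.lt_or_eq with h | h
    · rw [Nat.div_eq_of_lt_le (k := 1) (by omega) (by omega)]
      split_ifs <;> simp
    · rw [h, Nat.mul_mod_left, Nat.mul_div_cancel _ (by omega)]
      simp
  rw [vn_eq (by omega), classSum_of_consecutive k 1 h, classSum_of_consecutive k 1 h]
  norm_num
  constructor
  · ring
  · ring

/-- From `⌈n / 2⌉` classes on, all classes have size 1 or 2 and the density vector is affine in `k`;
such a vector lies on the segment from `k = ⌈n / 2⌉ - 1` to `k = n - 1`. -/
lemma vn_mem_convexHull_vertexSet {n k : ℕ} (hk : k < n) :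
    vn k n ∈ convexHull ℝ (vertexSet n) := by
  by_cases h : k < ⌈(n : ℝ) / 2⌉₊
  · exact subset_convexHull ℝ _ (Or.inl ⟨k, h, rfl⟩)
  rw [ceil_half] at h
  obtain ⟨c, hc⟩ : ∃ c, (n + 1) / 2 = c + 1 := ⟨(n + 1) / 2 - 1, by omega⟩
  have hcn : c + 1 < n := by omega
  have hck : c < k := by omega
  have h1 : vn c n ∈ convexHull ℝ (vertexSet n) :=
    subset_convexHull ℝ _ (Or.inl ⟨c, by rw [ceil_half]; omega, rfl⟩)
  have h2 : vn (n - 1) n ∈ convexHull ℝ (vertexSet n) :=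
    subset_convexHull ℝ _ (Or.inr rfl)
  have hcn' : (0 : ℝ) < n - (c + 1) := by
    have : (c : ℝ) + 1 < n := by exact_mod_cast hcn
    linarith
  have hck' : (c : ℝ) < k := by exact_mod_cast hck
  have hkn' : (k : ℝ) + 1 ≤ n := by exact_mod_cast hk
  have hmem := convex_convexHull ℝ (vertexSet n) h1 h2
    (a := (n - (k + 1)) / (n - (c + 1))) (b := (k - c) / (n - (c + 1)))
    (div_nonneg (by linarith) hcn'.le) (div_nonneg (by linarith) hcn'.le)
    (by rw [← add_div, div_eq_one_iff_eq hcn'.ne']; ring)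
  convert hmem using 1
  have hn0 : (n : ℝ) ≠ 0 := by exact_mod_cast (by omega : n ≠ 0)
  have hn1 : ((n - 1 : ℕ) : ℝ) = n - 1 := by rw [Nat.cast_sub (by omega)]; simp
  rw [vn_of_le_two_mul hk (by omega), vn_of_le_two_mul (k := c) (by omega) (by omega),
    vn_of_le_two_mul (k := n - 1) (by omega) (by omega), hn1]
  apply euclidean_two_ext
  · simp
    field_simp
    ring
  · simp
    field_simp
    ring

/-- A functional separating a graph from the hull would be an energy with smaller value at that
graph than at every Turán graph. -/
theorem Pn_eq_convexHull {n : ℕ} (hn : 1 ≤ n) : Pn n = convexHull ℝ (vertexSet n) := by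
  refine subset_antisymm (convexHull_min ?_ (convex_convexHull ℝ _)) (convexHull_mono ?_)
  · rintro _ ⟨G, rfl⟩
    by_contra hG
    obtain ⟨f, u, hf, hu⟩ := geometric_hahn_banach_point_closed (convex_convexHull ℝ _)
      ((finite_vertexSet n).isCompact_convexHull ℝ).isClosed hG
    have key : ∀ G : SimpleGraph (Fin n), f (tGraph G) =
        energy (f !₂[1, 0] / (n : ℝ) ^ 2) (f !₂[0, 1] / (n : ℝ) ^ 3) G 1 := by
      intro G
      rw [tGraph_eq, clm_euclidean_two, energy]
      ring
    obtain ⟨k, hk, hle⟩ := exists_turanGraph_energy_le (f !₂[1, 0] / (n : ℝ) ^ 2)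
      (f !₂[0, 1] / (n : ℝ) ^ 3) hn G
    rw [← key, ← key] at hle
    have := hu _ (vn_mem_convexHull_vertexSet hk)
    rw [vn] at this
    simp only at hf
    linarith
  · rintro x (⟨k, -, rfl⟩ | rfl)
    · exact ⟨_, rfl⟩
    · exact ⟨_, rfl⟩

/-! ### Chords between consecutive Turán vectors. -/

/-- The density vector of a complete multipartite graph with classes of relative size `x`. -/
def turanPoint (x : ℝ) : EuclideanSpace ℝ (Fin 2) := !₂[1 - x, 1 - 3 * x + 2 * x ^ 2]

lemma vn_of_dvd {n k : ℕ} (hn : 1 ≤ n) (h : k + 1 ∣ n) : vn k n = turanPoint (1 / (k + 1)) := by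
  obtain ⟨q, rfl⟩ := h
  have hq : ∀ i, classCard ((k + 1) * q) (k + 1) i = q ∨
      classCard ((k + 1) * q) (k + 1) i = q + 1 := by
    intro i
    rw [classCard_eq]
    simp
  have hq0 : (q : ℝ) ≠ 0 := by
    have : q ≠ 0 := by rintro rfl; simp at hn
    exact_mod_cast this
  have hk : (k : ℝ) + 1 ≠ 0 := by positivity
  rw [vn_eq hn, classSum_of_consecutive k q hq, classSum_of_consecutive k q hq, turanPoint]
  push_cast
  congr 2
  · field_simp
    ring
  · congr 1
    field_simp
    ring

lemma chordEnergy_eq {n A B : ℕ} (hn : 1 ≤ n) (G : SimpleGraph (Fin n)) :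
    chordEnergy n A B G 1 = (2 * (A + B) - 3 * n) * n ^ 2 * tGraph G 0 + n ^ 3 * tGraph G 1 -
      ((2 * (A + B) - 3 * n) * n ^ 2 + n ^ 3 - 2 * A * B * n) := by
  have hn0 : (n : ℝ) ≠ 0 := by exact_mod_cast (by omega : n ≠ 0)
  rw [tGraph_eq, chordEnergy, energy]
  simp
  field_simp

/-- On a multiple of `(k + 1) (k + 2)` vertices, a chord between consecutive Turán graphs contains
no density vectors but its end points. -/
theorem Ln_inter_S {k n : ℕ} (hn : 1 ≤ n) (h : (k + 1) * (k + 2) ∣ n) (hk : 1 ≤ k) :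
    Ln k n ∩ S n = {vn k n, vn (k + 1) n} := by
  refine subset_antisymm ?_ ?_
  · rintro x ⟨hx, G, rfl⟩
    obtain ⟨m, hndef⟩ := h
    have hm : 1 ≤ m := by
      by_contra! hc
      interval_cases m
      simp at hndef
      omega
    have hv1 : vn k n = turanPoint (1 / (k + 1)) :=
      vn_of_dvd hn ⟨(k + 2) * m, by rw [hndef]; ring⟩
    have hv2 : vn (k + 1) n = turanPoint (1 / ((k + 1 : ℕ) + 1)) :=
      vn_of_dvd hn ⟨(k + 1) * m, by rw [hndef]; ring⟩
    have hnR : (n : ℝ) = (k + 1) * (k + 2) * m := by rw [hndef]; push_cast; ring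
    have hm0 : (m : ℝ) ≠ 0 := by exact_mod_cast (by omega : m ≠ 0)
    have hk1 : (k : ℝ) + 1 ≠ 0 := by positivity
    have hk2 : (k : ℝ) + 2 ≠ 0 := by positivity
    obtain ⟨s, t, -, -, hst, hx⟩ := hx
    simp only at hx
    have h0 : chordEnergy n ((k + 2) * m) ((k + 1) * m) G 1 = 0 := by
      rw [chordEnergy_eq hn, ← hx, hv1, hv2, hnR]
      have hs : s = 1 - t := by linarith
      have hk3 : (k : ℝ) + 1 + 1 ≠ 0 := by positivity
      simp [turanPoint, hs]
      field_simp
      ring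
    -- The condition `A < 2 * B` reads `k + 2 < 2 * (k + 1)`, which is where `1 ≤ k` enters. For `k
    -- = 0` the chord carries all triangle-free graphs.
    obtain ⟨C, hC, hE, hT⟩ := forms_of_chordEnergy_eq_zero (r := k + 1) (by rw [hndef]; ring)
      (by rw [hndef]; ring) (by nlinarith) (by nlinarith) (Fintype.card_fin n) h0
    have hn0 : (n : ℝ) ≠ 0 := by exact_mod_cast (by omega : n ≠ 0)
    have hG : tGraph G = turanPoint (C / n) := by
      rw [tGraph_eq, hE, hT, turanPoint]
      congr 2
      · field_simp
      · congr 1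
        field_simp
    change tGraph G ∈ _
    rw [hG, hv1, hv2]
    rcases hC with rfl | rfl
    · left
      congr 1
      rw [hnR]; push_cast; field_simp
    · right
      rw [Set.mem_singleton_iff]
      congr 1
      rw [hnR]; push_cast; field_simp; ring
  · rintro x (rfl | rfl)
    · exact ⟨left_mem_segment ℝ _ _, _, rfl⟩
    · exact ⟨right_mem_segment ℝ _ _, _, rfl⟩

end Density

/-! ### Graphs as graphons -/

section Step

/-- The index of the part of `[0, 1]`, cut into `n` intervals of equal length, that contains `x`. -/
def partIndex (n : ℕ) [NeZero n] (x : I) : Fin n := Fin.ofNat n ⌊(x : ℝ) * n⌋₊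

lemma measurable_partIndex (n : ℕ) [NeZero n] : Measurable (partIndex n) :=
  (Measurable.of_discrete (f := Fin.ofNat n)).comp
    (Nat.measurable_floor.comp (measurable_subtype_coe.mul_const _))

lemma floor_lt {n : ℕ} [NeZero n] {x : I} (hx : x ≠ 1) : ⌊(x : ℝ) * n⌋₊ < n := by
  have hn : (0 : ℝ) < n := by exact_mod_cast Nat.pos_of_ne_zero (NeZero.ne n)
  rw [Nat.floor_lt (mul_nonneg x.2.1 hn.le)]
  have : (x : ℝ) < 1 := lt_of_le_of_ne x.2.2 fun h => hx (Subtype.ext h)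
  nlinarith

lemma val_partIndex {n : ℕ} [NeZero n] {x : I} (hx : x ≠ 1) :
    (partIndex n x : ℕ) = ⌊(x : ℝ) * n⌋₊ :=
  Nat.mod_eq_of_lt (floor_lt hx)

lemma volume_partIndex_preimage (n : ℕ) [NeZero n] (i : Fin n) :
    volume (partIndex n ⁻¹' {i}) = ENNReal.ofReal (1 / n) := by
  have hn : (0 : ℝ) < n := by exact_mod_cast Nat.pos_of_ne_zero (NeZero.ne n)
  have hi : (i : ℝ) + 1 ≤ n := by exact_mod_cast i.2
  let p : I := ⟨i / n, by positivity, by rw [div_le_one hn]; linarith⟩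
  let q : I := ⟨(i + 1) / n, by positivity, by rw [div_le_one hn]; linarith⟩
  -- Only almost everywhere: at `x = 1` the floor is `n`, and `Fin.ofNat` wraps it to 0.
  have h : partIndex n ⁻¹' {i} =ᵐ[volume] Set.Ico p q := by
    have hne : ∀ᵐ x : I, x ≠ 1 := compl_mem_ae_iff.2 (measure_singleton 1)
    filter_upwards [hne] with x hx
    refine propext ?_
    change partIndex n x = i ↔ p ≤ x ∧ x < q
    rw [Fin.ext_iff, val_partIndex hx, Nat.floor_eq_iff (mul_nonneg x.2.1 hn.le),
      ← Subtype.coe_le_coe, ← Subtype.coe_lt_coe]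
    change _ ↔ (i : ℝ) / n ≤ x ∧ (x : ℝ) < (i + 1) / n
    rw [div_le_iff₀ hn, lt_div_iff₀ hn]
  rw [measure_congr h, unitInterval.volume_Ico]
  congr 1
  change ((i : ℝ) + 1) / n - i / n = 1 / n
  ring

/-- The graphon of a graph. -/
def stepGraphon {n : ℕ} [NeZero n] (G : SimpleGraph (Fin n)) : Graphon where
  toFun x y := adj G (partIndex n x) (partIndex n y)
  measurable_toFun :=
    (Measurable.of_discrete (f := fun p : Fin n × Fin n => adj G p.1 p.2)).comp
      (((measurable_partIndex n).comp measurable_fst).prodMk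
        ((measurable_partIndex n).comp measurable_snd))
  symm x y := adj_comm G _ _
  mem_Icc x y := by unfold adj; split_ifs <;> simp

/-- Averaging over the parts. -/
lemma integral_partIndex {m n : ℕ} [NeZero n] (Φ : (Fin m → Fin n) → ℝ) :
    ∫ x : Fin m → I, Φ (fun i => partIndex n (x i)) = (∑ g, Φ g) / (n : ℝ) ^ m := by
  have hn : (0 : ℝ) < n := by exact_mod_cast Nat.pos_of_ne_zero (NeZero.ne n)
  have hprob : IsProbabilityMeasure ((volume : Measure I).map (partIndex n)) :=
    Measure.isProbabilityMeasure_map (measurable_partIndex n).aemeasurable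
  -- The sample of part indices is a product of uniform measures on `Fin n`, so each `g` has mass `1
  -- / n ^ m`.
  have hmap : (volume : Measure (Fin m → I)).map (fun x i => partIndex n (x i)) =
      Measure.pi fun _ => (volume : Measure I).map (partIndex n) := by
    rw [volume_pi]
    exact Measure.pi_map_pi fun _ => (measurable_partIndex n).aemeasurable
  have hmeas : Measurable fun (x : Fin m → I) i => partIndex n (x i) :=
    measurable_pi_lambda _ fun i => (measurable_partIndex n).comp (measurable_pi_apply i)
  rw [← integral_map (φ := fun (x : Fin m → I) i => partIndex n (x i)) (f := Φ)
    hmeas.aemeasurable Measurable.of_discrete.aestronglyMeasurable, hmap,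
    integral_fintype Integrable.of_finite, Finset.sum_div]
  refine Finset.sum_congr rfl fun g _ => ?_
  rw [measureReal_def, Measure.pi_singleton]
  have : ∀ i, (volume : Measure I).map (partIndex n) {g i} = ENNReal.ofReal (1 / n) := fun i => by
    rw [Measure.map_apply (measurable_partIndex n) (measurableSet_singleton _),
      volume_partIndex_preimage]
  simp only [this, Finset.prod_const, Finset.card_univ, Fintype.card_fin, ENNReal.toReal_pow]
  rw [ENNReal.toReal_ofReal (one_div_nonneg.2 hn.le), smul_eq_mul, one_div, inv_pow, div_eq_inv_mul]

lemma homDensity_stepGraphon {m n : ℕ} [NeZero n] (G : SimpleGraph (Fin n))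
    (H : SimpleGraph (Fin m)) [DecidableRel H.Adj] :
    (stepGraphon G).homDensity H = homDensity H G := by
  rw [homDensity, card_hom_eq_sum, ← integral_partIndex, Graphon.homDensity]
  refine integral_congr_ae (Eventually.of_forall fun x => Finset.prod_congr rfl fun e _ => ?_)
  induction e with
  | h i j => exact (edgeInd_mk G _ _).symm

lemma tGraphon_stepGraphon {n : ℕ} [NeZero n] (G : SimpleGraph (Fin n)) :
    tGraphon (stepGraphon G) = tGraph G := by
  rw [tGraphon, tGraph, homDensity_stepGraphon, homDensity_stepGraphon]

lemma S_subset_R {n : ℕ} (hn : 1 ≤ n) : S n ⊆ R := by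
  have : NeZero n := ⟨by omega⟩
  rintro _ ⟨G, rfl⟩
  exact ⟨stepGraphon G, tGraphon_stepGraphon G⟩

lemma Pn_subset_P {n : ℕ} (hn : 1 ≤ n) : Pn n ⊆ P := convexHull_mono (S_subset_R hn)

/-- The endpoint 1, where the floors in `turanGraphon` and `partIndex` disagree, is negligible. -/
lemma homDensity_congr {f g : Graphon}
    (h : ∀ x y : I, x ≠ 1 → y ≠ 1 → f.toFun x y = g.toFun x y) {m : ℕ} (H : SimpleGraph (Fin m))
    [DecidableRel H.Adj] : f.homDensity H = g.homDensity H := by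
  have hne : ∀ᵐ x : Fin m → I, ∀ i, x i ≠ 1 :=
    eventually_all.2 fun i => Measure.ae_eval_ne (fun _ : Fin m => (volume : Measure I)) i 1
  refine integral_congr_ae ?_
  filter_upwards [hne] with x hx
  refine Finset.prod_congr rfl fun e _ => ?_
  induction e with
  | h i j => exact h _ _ (hx i) (hx j)

lemma turanGraphon_toFun {k : ℕ} {x y : I} (hx : x ≠ 1) (hy : y ≠ 1) :
    (turanGraphon (k + 1)).toFun x y =
      (stepGraphon (⊤ : SimpleGraph (Fin (k + 1)))).toFun x y := by
  have h1 : (stepGraphon (⊤ : SimpleGraph (Fin (k + 1)))).toFun x y =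
      if ⌊(x : ℝ) * (k + 1 : ℕ)⌋₊ = ⌊(y : ℝ) * (k + 1 : ℕ)⌋₊ then 0 else 1 := by
    change adj _ _ _ = _
    split_ifs with h
    · refine adj_of_not_adj ?_
      rw [SimpleGraph.top_adj, not_not, Fin.ext_iff, val_partIndex hx, val_partIndex hy]
      exact h
    · refine adj_of_adj ?_
      rw [SimpleGraph.top_adj, ne_eq, Fin.ext_iff, val_partIndex hx, val_partIndex hy]
      exact h
  have hx0 : (0 : ℝ) ≤ (x : ℝ) * (k + 1 : ℕ) := mul_nonneg x.2.1 (Nat.cast_nonneg _)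
  have hy0 : (0 : ℝ) ≤ (y : ℝ) * (k + 1 : ℕ) := mul_nonneg y.2.1 (Nat.cast_nonneg _)
  rw [h1, turanGraphon]
  split_ifs with hk h h
  · rfl
  · have h2 := floor_lt (n := k + 1) hx
    have h3 := floor_lt (n := k + 1) hy
    omega
  · change (if ⌊(x : ℝ) * (k + 1 : ℕ)⌋ = ⌊(y : ℝ) * (k + 1 : ℕ)⌋ then (0 : ℝ) else 1) = 0
    rw [if_pos]
    rw [← Int.natCast_floor_eq_floor hx0, ← Int.natCast_floor_eq_floor hy0, h]
  · change (if ⌊(x : ℝ) * (k + 1 : ℕ)⌋ = ⌊(y : ℝ) * (k + 1 : ℕ)⌋ then (0 : ℝ) else 1) = 1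
    rw [if_neg]
    rw [← Int.natCast_floor_eq_floor hx0, ← Int.natCast_floor_eq_floor hy0]
    exact_mod_cast h

/-- The Turán graph with as many classes as vertices is complete, and its step graphon agrees with
the Turán graphon away from the endpoint 1. -/
lemma v_eq_vn (k : ℕ) : v k = vn k (k + 1) := by
  have htop : SimpleGraph.turanGraph (k + 1) (k + 1) = ⊤ :=
    SimpleGraph.turanGraph_eq_top.2 (Or.inr le_rfl)
  rw [v, vn, htop, ← tGraphon_stepGraphon, tGraphon, tGraphon,
    homDensity_congr fun _ _ hx hy => turanGraphon_toFun hx hy,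
    homDensity_congr fun _ _ hx hy => turanGraphon_toFun hx hy]

lemma v_eq_turanPoint (k : ℕ) : v k = turanPoint (1 / (k + 1)) := by
  rw [v_eq_vn, vn_of_dvd (by omega) dvd_rfl]

end Step

/-! ### Sampling -/

section Sampling

open Classical in
/-- The probability that a random set containing each `e` independently with probability `w e`
equals `B`. -/
def bernoulliWeight {ι : Type*} [Fintype ι] (w : ι → ℝ) (B : Finset ι) : ℝ :=
  (∏ e ∈ B, w e) * ∏ e ∈ Bᶜ, (1 - w e)

-- This is the probability that the random set contains `A`. Expanding `∏ (w e + (1 - w e))` with `1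
-- - w e` replaced by 0 on `A` kills every `B` not containing `A`.
open Classical in
lemma prod_eq_sum_bernoulliWeight {ι : Type*} [Fintype ι] (w : ι → ℝ) (A : Finset ι)
    {c : Finset ι → ℝ} (hc : ∀ B, A ⊆ B → c B = 1) (hc' : ∀ B, ¬ A ⊆ B → c B = 0) :
    ∏ e ∈ A, w e = ∑ B, bernoulliWeight w B * c B := by
  have h := Fintype.prod_add w fun e => if e ∈ A then 0 else 1 - w e
  have hl : ∏ e, (w e + if e ∈ A then 0 else 1 - w e) = ∏ e ∈ A, w e := by
    rw [← Finset.prod_subset (Finset.subset_univ A)]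
    · exact Finset.prod_congr rfl fun e he => by simp [he]
    · intro e _ he
      simp [he]
  rw [← hl, h]
  refine Finset.sum_congr rfl fun B _ => ?_
  unfold bernoulliWeight
  by_cases hAB : A ⊆ B
  · rw [hc B hAB, mul_one]
    congr 1
    refine Finset.prod_congr rfl fun e he => if_neg fun h => ?_
    exact Finset.mem_compl.1 he (hAB h)
  · rw [hc' B hAB, mul_zero]
    obtain ⟨e, heA, heB⟩ := Finset.not_subset.1 hAB
    have h0 : ∏ e ∈ Bᶜ, (if e ∈ A then 0 else 1 - w e) = 0 :=
      Finset.prod_eq_zero (Finset.mem_compl.2 heB) (if_pos heA)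
    rw [h0, mul_zero]

variable {m n : ℕ}

lemma Graphon.pairValue_map (f : Graphon) (x : Fin n → I) (g : Fin m → Fin n)
    (e : Sym2 (Fin m)) : f.pairValue x (e.map g) = f.pairValue (fun i => x (g i)) e := by
  induction e with
  | h i j => rfl

lemma Graphon.pairValue_mem (f : Graphon) (x : Fin n → I) (e : Sym2 (Fin n)) :
    f.pairValue x e ∈ Set.Icc (0 : ℝ) 1 := by
  induction e with
  | h i j => exact f.mem_Icc _ _

lemma Graphon.measurable_pairValue (f : Graphon) (e : Sym2 (Fin n)) :
    Measurable fun x : Fin n → I => f.pairValue x e := by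
  induction e with
  | h i j =>
    have h : Measurable fun x : Fin n → I => (x i, x j) :=
      (measurable_pi_apply i).prodMk (measurable_pi_apply j)
    exact f.measurable_toFun.comp h

/-- The product of the values of a graphon over the edges of a clique on sample points. -/
def cliqueValue (f : Graphon) (x : Fin m → I) : ℝ :=
  ∏ e ∈ (⊤ : SimpleGraph (Fin m)).edgeFinset, f.pairValue x e

lemma integral_cliqueValue (f : Graphon) :
    ∫ x : Fin m → I, cliqueValue f x = f.homDensity (⊤ : SimpleGraph (Fin m)) := rfl

lemma cliqueValue_mem (f : Graphon) (x : Fin m → I) : cliqueValue f x ∈ Set.Icc (0 : ℝ) 1 :=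
  ⟨Finset.prod_nonneg fun e _ => (f.pairValue_mem x e).1,
    Finset.prod_le_one (fun e _ => (f.pairValue_mem x e).1) fun e _ => (f.pairValue_mem x e).2⟩

lemma measurable_cliqueValue (f : Graphon) : Measurable fun x : Fin m → I => cliqueValue f x :=
  Finset.measurable_prod _ fun e _ => f.measurable_pairValue e

lemma integrable_of_mem_Icc {α : Type*} [MeasurableSpace α] {μ : Measure α} [IsFiniteMeasure μ]
    {φ : α → ℝ} (hm : Measurable φ) (h : ∀ x, φ x ∈ Set.Icc (0 : ℝ) 1) : Integrable φ μ :=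
  Integrable.of_bound hm.aestronglyMeasurable 1 (Eventually.of_forall fun x => by
    rw [Real.norm_eq_abs, abs_of_nonneg (h x).1]; exact (h x).2)

/-- Selecting distinct coordinates of a uniform sample yields a uniform sample. -/
lemma measurePreserving_comp_embedding (g : Fin m ↪ Fin n) :
    MeasurePreserving (fun (x : Fin n → I) i => x (g i)) volume volume := by
  have hmeas : Measurable fun (x : Fin n → I) i => x (g i) :=
    measurable_pi_lambda _ fun i => measurable_pi_apply _
  refine ⟨hmeas, ?_⟩
  rw [volume_pi, volume_pi]
  symm
  refine Measure.pi_eq fun s hs => ?_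
  rw [Measure.map_apply hmeas (MeasurableSet.univ_pi hs)]
  classical
  -- The preimage of a box is a box: side `s i` at coordinate `g i`, and the whole interval, as an
  -- empty intersection, off the range of `g`.
  have hset : (fun (x : Fin n → I) i => x (g i)) ⁻¹' Set.univ.pi s =
      Set.univ.pi fun j => ⋂ i, ⋂ (_ : g i = j), s i := by
    ext x
    simp only [Set.mem_preimage, Set.mem_pi, Set.mem_univ, true_imp_iff, Set.mem_iInter]
    exact ⟨fun h j i hij => hij ▸ h i, fun h i => h (g i) i rfl⟩
  rw [hset, Measure.pi_pi]
  have h1 : ∀ j ∉ Finset.univ.map g, volume (⋂ i, ⋂ (_ : g i = j), s i) = 1 := by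
    intro j hj
    have : (⋂ i, ⋂ (_ : g i = j), s i) = Set.univ := by
      simp only [Set.iInter_eq_univ]
      exact fun i hi => absurd (by simp [← hi]) hj
    rw [this, measure_univ]
  rw [← Finset.prod_subset (Finset.subset_univ (Finset.univ.map g)) fun j _ hj => h1 j hj,
    Finset.prod_map]
  refine Finset.prod_congr rfl fun i _ => ?_
  congr 1
  ext y
  simp [g.injective.eq_iff]

/-- The injective clique density of the weighted graph sampled from a graphon. -/
def sampleDensity (m : ℕ) (f : Graphon) (x : Fin n → I) : ℝ :=
  (∑ g : Fin m ↪ Fin n, cliqueValue f fun i => x (g i)) / (n : ℝ) ^ m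

lemma integrable_cliqueValue_comp (f : Graphon) (g : Fin m ↪ Fin n) :
    Integrable fun x : Fin n → I => cliqueValue f fun i => x (g i) :=
  integrable_of_mem_Icc
    ((measurable_cliqueValue f).comp (measurePreserving_comp_embedding g).measurable)
    fun _ => cliqueValue_mem f _

lemma integrable_sampleDensity (m : ℕ) (f : Graphon) :
    Integrable fun x : Fin n → I => sampleDensity m f x :=
  (integrable_finsetSum _ fun g _ => integrable_cliqueValue_comp f g).div_const _

lemma integral_sampleDensity (m : ℕ) (f : Graphon) :
    ∫ x : Fin n → I, sampleDensity m f x =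
      (n.descFactorial m : ℝ) / (n : ℝ) ^ m * f.homDensity (⊤ : SimpleGraph (Fin m)) := by
  have h : ∀ g : Fin m ↪ Fin n, ∫ x : Fin n → I, cliqueValue f (fun i => x (g i)) =
      f.homDensity (⊤ : SimpleGraph (Fin m)) := by
    intro g
    have hp := measurePreserving_comp_embedding g
    rw [← integral_cliqueValue, ← hp.map_eq, integral_map hp.measurable.aemeasurable
      (measurable_cliqueValue f).aestronglyMeasurable]
  simp only [sampleDensity]
  rw [integral_div, integral_finsetSum _ fun g _ => integrable_cliqueValue_comp f g,
    Finset.sum_congr rfl fun g _ => h g]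
  simp [Fintype.card_embedding_eq]
  ring

/-- The graph with edges in `B`. -/
def edgeGraph (B : Finset (Sym2 (Fin n))) : SimpleGraph (Fin n) :=
  SimpleGraph.fromEdgeSet (B : Set (Sym2 (Fin n)))

/-- `SimpleGraph.fromEdgeSet` discards the loops in `B`, but an embedding sends no edge of the
clique to a loop. -/
lemma map_mem_edgeSet_edgeGraph (B : Finset (Sym2 (Fin n))) (g : Fin m ↪ Fin n) {e : Sym2 (Fin m)}
    (he : e ∈ (⊤ : SimpleGraph (Fin m)).edgeFinset) :
    e.map g ∈ (edgeGraph B).edgeSet ↔ e.map g ∈ B := by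
  induction e with
  | h i j =>
    have hij : i ≠ j := by simpa using he
    simp [edgeGraph, g.injective.ne hij]

lemma prod_edgeInd_edgeGraph_of_subset {B : Finset (Sym2 (Fin n))} {g : Fin m ↪ Fin n}
    (h : (⊤ : SimpleGraph (Fin m)).edgeFinset.image (Sym2.map g) ⊆ B) :
    ∏ e ∈ (⊤ : SimpleGraph (Fin m)).edgeFinset, edgeInd (edgeGraph B) (e.map g) = 1 :=
  Finset.prod_eq_one fun e he =>
    if_pos ((map_mem_edgeSet_edgeGraph B g he).2 (Finset.image_subset_iff.1 h e he))

lemma prod_edgeInd_edgeGraph_of_not_subset {B : Finset (Sym2 (Fin n))} {g : Fin m ↪ Fin n}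
    (h : ¬ (⊤ : SimpleGraph (Fin m)).edgeFinset.image (Sym2.map g) ⊆ B) :
    ∏ e ∈ (⊤ : SimpleGraph (Fin m)).edgeFinset, edgeInd (edgeGraph B) (e.map g) = 0 := by
  rw [Finset.image_subset_iff] at h
  push Not at h
  obtain ⟨e, he, heB⟩ := h
  exact Finset.prod_eq_zero he (if_neg fun h => heB ((map_mem_edgeSet_edgeGraph B g he).1 h))

lemma prod_edgeInd_of_not_injective (G : SimpleGraph (Fin n)) {g : Fin m → Fin n}
    (hg : ¬ Function.Injective g) :
    ∏ e ∈ (⊤ : SimpleGraph (Fin m)).edgeFinset, edgeInd G (e.map g) = 0 := by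
  simp only [Function.Injective, not_forall] at hg
  obtain ⟨i, j, hij, hne⟩ := hg
  refine Finset.prod_eq_zero (i := s(i, j)) (by simpa using hne) ?_
  rw [Sym2.map_mk, edgeInd_mk, hij, adj_self]

lemma homDensity_top_eq_sum_embedding (G : SimpleGraph (Fin n)) :
    homDensity (⊤ : SimpleGraph (Fin m)) G =
      (∑ g : Fin m ↪ Fin n,
        ∏ e ∈ (⊤ : SimpleGraph (Fin m)).edgeFinset, edgeInd G (e.map g)) / (n : ℝ) ^ m := by
  classical
  rw [homDensity, card_hom_eq_sum]
  congr 1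
  have h1 : ∑ g : Fin m → Fin n, ∏ e ∈ (⊤ : SimpleGraph (Fin m)).edgeFinset, edgeInd G (e.map g) =
      ∑ g ∈ Finset.univ.filter fun g : Fin m → Fin n => Function.Injective g,
        ∏ e ∈ (⊤ : SimpleGraph (Fin m)).edgeFinset, edgeInd G (e.map g) := by
    rw [Finset.sum_filter]
    refine Finset.sum_congr rfl fun g _ => ?_
    split_ifs with h
    · rfl
    · exact prod_edgeInd_of_not_injective G h
  rw [h1]
  symm
  refine Finset.sum_bij (fun g _ => (g : Fin m → Fin n)) (fun g _ => by simp [g.injective])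
    (fun g _ g' _ h => DFunLike.coe_injective h)
    (fun g hg => ⟨⟨g, (Finset.mem_filter.1 hg).2⟩, Finset.mem_univ _, rfl⟩) fun g _ => rfl

/-- The weighted sample is a mixture of graphs. -/
lemma sampleDensity_eq (m : ℕ) (f : Graphon) (x : Fin n → I) :
    sampleDensity m f x = ∑ B, bernoulliWeight (f.pairValue x) B *
      homDensity (⊤ : SimpleGraph (Fin m)) (edgeGraph B) := by
  classical
  simp only [homDensity_top_eq_sum_embedding, ← mul_div_assoc]
  rw [← Finset.sum_div, sampleDensity]
  congr 1
  simp only [Finset.mul_sum]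
  rw [Finset.sum_comm]
  refine Finset.sum_congr rfl fun g _ => ?_
  have h := prod_eq_sum_bernoulliWeight (f.pairValue x)
    ((⊤ : SimpleGraph (Fin m)).edgeFinset.image (Sym2.map g))
    (fun B => prod_edgeInd_edgeGraph_of_subset) (fun B => prod_edgeInd_edgeGraph_of_not_subset)
  rw [Finset.prod_image (Sym2.map.injective g.injective).injOn] at h
  rw [← h, cliqueValue]
  exact Finset.prod_congr rfl fun e _ => (f.pairValue_map x g e).symm

/-- The mixture weights do not depend on `m`, so both coordinates are averages over the same random
graph. -/
lemma sample_mem_Pn (f : Graphon) (x : Fin n → I) :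
    !₂[sampleDensity 2 f x, sampleDensity 3 f x] ∈ Pn n := by
  have h : !₂[sampleDensity 2 f x, sampleDensity 3 f x] =
      ∑ B, bernoulliWeight (f.pairValue x) B • tGraph (edgeGraph B) := by
    apply euclidean_two_ext
    · simp [sampleDensity_eq, tGraph]
    · simp [sampleDensity_eq, tGraph]
  rw [h]
  refine (convex_convexHull ℝ _).sum_mem (fun B _ => ?_) ?_ fun B _ =>
    subset_convexHull ℝ _ ⟨_, rfl⟩
  · exact mul_nonneg (Finset.prod_nonneg fun e _ => (f.pairValue_mem x e).1)
      (Finset.prod_nonneg fun e _ => sub_nonneg.2 (f.pairValue_mem x e).2)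
  · have := prod_eq_sum_bernoulliWeight (f.pairValue x) ∅ (c := fun _ => 1) (fun _ _ => rfl)
      (fun B h => absurd (Finset.empty_subset B) h)
    simpa using this.symm

lemma isCompact_Pn (n : ℕ) : IsCompact (Pn n) :=
  (Set.finite_range _).isCompact_convexHull ℝ

/-- The expected density vector of a random graph sampled from a graphon lies in the polytope. -/
theorem sample_expectation_mem_Pn (f : Graphon) (n : ℕ) :
    !₂[(n.descFactorial 2 : ℝ) / (n : ℝ) ^ 2 * f.homDensity (⊤ : SimpleGraph (Fin 2)),
      (n.descFactorial 3 : ℝ) / (n : ℝ) ^ 3 * f.homDensity (⊤ : SimpleGraph (Fin 3))] ∈ Pn n := by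
  by_contra hc
  -- The expectation of points of a closed convex set stays in it: a strict separation would
  -- contradict integrating the pointwise inequality.
  obtain ⟨φ, u, hφ, hu⟩ := geometric_hahn_banach_point_closed (convex_convexHull ℝ _)
    (isCompact_Pn n).isClosed hc
  rw [clm_euclidean_two, ← integral_sampleDensity, ← integral_sampleDensity,
    ← integral_mul_const, ← integral_mul_const, ← integral_add
      ((integrable_sampleDensity 2 f).mul_const _) ((integrable_sampleDensity 3 f).mul_const _)]
    at hφ
  have h2 : u ≤ ∫ x : Fin n → I, (sampleDensity 2 f x * φ !₂[1, 0] +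
      sampleDensity 3 f x * φ !₂[0, 1]) := by
    have : ∫ _ : Fin n → I, u = u := by simp
    rw [← this]
    refine integral_mono (integrable_const _) (((integrable_sampleDensity 2 f).mul_const _).add
      ((integrable_sampleDensity 3 f).mul_const _)) fun x => ?_
    have := hu _ (sample_mem_Pn f x)
    rw [clm_euclidean_two] at this
    exact this.le
  linarith

end Sampling

/-! ### Convergence of the polytopes -/

section Limit

/-- In finite dimension the convex hull of a compact set is compact. -/
lemma isCompact_convexHull_of_isCompact {E : Type*} [NormedAddCommGroup E] [NormedSpace ℝ E]
    [FiniteDimensional ℝ E] {K : Set E} (hK : IsCompact K) : IsCompact (convexHull ℝ K) := by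
  -- By Carathéodory, at most `finrank + 1` points are needed, so the hull is a finite union of
  -- continuous images of simplices times powers of `K`.
  let Φ : ∀ c : ℕ, (Fin c → ℝ) × (Fin c → E) → E := fun c p => ∑ i, p.1 i • p.2 i
  have hΦ : ∀ c, Continuous (Φ c) := fun c => by fun_prop
  have h : convexHull ℝ K = ⋃ c ∈ Finset.range (Module.finrank ℝ E + 2),
      Φ c '' (stdSimplex ℝ (Fin c) ×ˢ Set.univ.pi fun _ => K) := by
    refine subset_antisymm (fun x hx => ?_) ?_
    · obtain ⟨ι, _, z, w, hz, hind, hw, hw1, hx⟩ := eq_pos_convex_span_of_mem_convexHull hx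
      have hcard : Fintype.card ι ≤ Module.finrank ℝ E + 1 :=
        hind.card_le_finrank_succ.trans (Nat.succ_le_succ (Submodule.finrank_le _))
      let e := Fintype.equivFin ι
      simp only [Set.mem_iUnion]
      refine ⟨Fintype.card ι, by simp; omega, ⟨w ∘ e.symm, z ∘ e.symm⟩, ⟨⟨?_, ?_⟩, ?_⟩, ?_⟩
      · exact fun i => (hw _).le
      · rw [← hw1]; exact Equiv.sum_comp e.symm w
      · exact fun i _ => hz ⟨_, rfl⟩
      · rw [← hx]; exact Equiv.sum_comp e.symm fun i => w i • z i
    · simp only [Set.iUnion_subset_iff]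
      rintro c - _ ⟨⟨w, z⟩, ⟨hw, hz⟩, rfl⟩
      exact (convex_convexHull ℝ K).sum_mem (fun i _ => hw.1 i) hw.2
        fun i _ => subset_convexHull ℝ K (hz i trivial)
  rw [h]
  exact Finset.isCompact_biUnion _ fun c _ =>
    ((isCompact_stdSimplex ℝ (Fin c)).prod (isCompact_univ_pi fun _ => hK)).image (hΦ c)

lemma dist_euclidean_two_le (a b c d : ℝ) :
    dist (!₂[a, b] : EuclideanSpace ℝ (Fin 2)) !₂[c, d] ≤ |a - c| + |b - d| := by
  rw [EuclideanSpace.dist_eq]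
  simp only [Fin.sum_univ_two, Real.dist_eq]
  refine Real.sqrt_le_iff.2 ⟨by positivity, ?_⟩
  change |a - c| ^ 2 + |b - d| ^ 2 ≤ _
  nlinarith [mul_nonneg (abs_nonneg (a - c)) (abs_nonneg (b - d))]

lemma Graphon.homDensity_top_mem (f : Graphon) (m : ℕ) :
    f.homDensity (⊤ : SimpleGraph (Fin m)) ∈ Set.Icc (0 : ℝ) 1 := by
  rw [← integral_cliqueValue]
  refine ⟨integral_nonneg fun x => (cliqueValue_mem f x).1, ?_⟩
  have h1 : ∫ _ : Fin m → I, (1 : ℝ) = 1 := by simp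
  rw [← h1]
  exact integral_mono (integrable_of_mem_Icc (measurable_cliqueValue f) (cliqueValue_mem f))
    (integrable_const _) fun x => (cliqueValue_mem f x).2

/-- The proportion of non-injective maps is `1 / n` for pairs and `(3 n - 2) / n ^ 2 ≤ 3 / n` for
triples; this gives the 4. -/
lemma exists_dist_tGraphon_le (f : Graphon) {n : ℕ} (hn : 2 ≤ n) :
    ∃ y ∈ Pn n, dist (tGraphon f) y ≤ 4 / n := by
  refine ⟨_, sample_expectation_mem_Pn f n, (dist_euclidean_two_le _ _ _ _).trans ?_⟩
  obtain ⟨k, rfl⟩ : ∃ k, n = k + 2 := ⟨n - 2, by omega⟩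
  have hk : (0 : ℝ) ≤ k := Nat.cast_nonneg k
  obtain ⟨h20, h21⟩ := f.homDensity_top_mem 2
  obtain ⟨h30, h31⟩ := f.homDensity_top_mem 3
  set s := f.homDensity (⊤ : SimpleGraph (Fin 2))
  set t := f.homDensity (⊤ : SimpleGraph (Fin 3))
  have e2 : s - ((k + 2).descFactorial 2 : ℝ) / ((k + 2 : ℕ) : ℝ) ^ 2 * s = s * (1 / (k + 2)) := by
    simp [Nat.descFactorial]
    field_simp
    ring
  have e3 : t - ((k + 2).descFactorial 3 : ℝ) / ((k + 2 : ℕ) : ℝ) ^ 3 * t =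
      t * ((3 * k + 4) / (k + 2) ^ 2) := by
    simp [Nat.descFactorial]
    field_simp
    ring
  have b3 : (3 * (k : ℝ) + 4) / (k + 2) ^ 2 ≤ 3 / (k + 2) := by
    rw [div_le_div_iff₀ (by positivity) (by positivity)]
    nlinarith
  rw [e2, e3, abs_of_nonneg (mul_nonneg h20 (by positivity)),
    abs_of_nonneg (mul_nonneg h30 (by positivity))]
  have c2 : s * (1 / ((k : ℝ) + 2)) ≤ 1 / (k + 2) := mul_le_of_le_one_left (by positivity) h21
  have c3 : t * ((3 * (k : ℝ) + 4) / (k + 2) ^ 2) ≤ 3 / (k + 2) :=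
    (mul_le_of_le_one_left (by positivity) h31).trans b3
  have : (4 : ℝ) / ((k + 2 : ℕ) : ℝ) = 1 / (k + 2) + 3 / (k + 2) := by push_cast; ring
  rw [this]
  exact add_le_add c2 c3

lemma P_subset_cthickening {n : ℕ} (hn : 2 ≤ n) : P ⊆ Metric.cthickening (4 / n) (Pn n) := by
  refine convexHull_min ?_ ((convex_convexHull ℝ _).cthickening _)
  rintro _ ⟨f, rfl⟩
  obtain ⟨y, hy, hd⟩ := exists_dist_tGraphon_le f hn
  exact Metric.mem_cthickening_of_dist_le _ y _ _ hy hd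

lemma tendsto_const_div (c : ℝ) : Tendsto (fun n : ℕ => ENNReal.ofReal (c / n)) atTop (𝓝 0) := by
  have := ENNReal.tendsto_ofReal (tendsto_const_div_atTop_nhds_zero_nat c)
  rwa [ENNReal.ofReal_zero] at this

theorem tendsto_hausdorffEDist_Pn :
    Tendsto (fun n : ℕ => Metric.hausdorffEDist (Pn n) P) atTop (𝓝 0) := by
  refine tendsto_of_tendsto_of_tendsto_of_le_of_le' tendsto_const_nhds (tendsto_const_div 4)
    (Eventually.of_forall fun _ => zero_le) ?_
  filter_upwards [eventually_ge_atTop 2] with n hn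
  refine Metric.hausdorffEDist_le_of_infEDist (fun x hx => ?_) fun x hx => ?_
  · rw [Metric.infEDist_zero_of_mem (Pn_subset_P (by omega) hx)]
    exact zero_le
  · exact Metric.mem_cthickening_iff.1 (P_subset_cthickening hn hx)

/-! ### Compactness of `P` through the hull of the Turán vectors. -/

lemma abs_classCard_div_sub_le {n : ℕ} (hn : 1 ≤ n) (r : ℕ) [NeZero r] (i : Fin r) :
    |(classCard n r i : ℝ) / n - 1 / r| ≤ 1 / n := by
  have hn' : (0 : ℝ) < n := by exact_mod_cast hn
  have hr : 0 < r := Nat.pos_of_ne_zero (NeZero.ne r)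
  have hr' : (0 : ℝ) < r := by exact_mod_cast hr
  have h1 : ((n / r : ℕ) : ℝ) * r ≤ n := by exact_mod_cast Nat.div_mul_le_self n r
  have h2 : (n : ℝ) ≤ (((n / r : ℕ) : ℝ) + 1) * r := by
    have : n ≤ (n / r + 1) * r := by
      rw [mul_comm]; exact (Nat.lt_mul_div_succ n hr).le
    exact_mod_cast this
  have h3 : ((n / r : ℕ) : ℝ) ≤ n / r := by rwa [le_div_iff₀ hr']
  have h4 : (n : ℝ) / r ≤ ((n / r : ℕ) : ℝ) + 1 := by rwa [div_le_iff₀ hr']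
  have h5 : (classCard n r i : ℝ) / n - 1 / r = ((classCard n r i : ℝ) - n / r) / n := by
    field_simp
  rw [h5, abs_div, abs_of_pos hn']
  refine div_le_div_of_nonneg_right ?_ hn'.le
  rcases classCard_consecutive n r i with h | h <;> rw [h, abs_le] <;> push_cast <;>
    constructor <;> linarith

/-- The relative class sizes sum to 1, so a power sum is a weighted mean of lower powers, each close
to that of `1 / (k + 1)`. The bound is therefore uniform in `k`, as needed when the number of
vertices of `Pn` grows. The errors add up to `1 + 3 * 1 + 2 * 2 = 8`. -/
lemma dist_vn_v_le {n : ℕ} (hn : 1 ≤ n) (k : ℕ) : dist (vn k n) (v k) ≤ 8 / n := by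
  have hn' : (0 : ℝ) < n := by exact_mod_cast hn
  set x : Fin (k + 1) → ℝ := fun i => (classCard n (k + 1) i : ℝ) / n with hx
  set y : ℝ := 1 / ((k : ℝ) + 1) with hy
  have hy0 : 0 ≤ y := by positivity
  have hy1 : y ≤ 1 := by
    rw [hy, div_le_one (by positivity)]
    linarith [(Nat.cast_nonneg k : (0 : ℝ) ≤ k)]
  have hx0 : ∀ i, 0 ≤ x i := fun i => by positivity
  have hsum : ∑ i, x i = 1 := by
    rw [hx, ← Finset.sum_div, div_eq_one_iff_eq hn'.ne']
    exact_mod_cast sum_classCard n (k + 1)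
  have hx1 : ∀ i, x i ≤ 1 := fun i =>
    hsum ▸ Finset.single_le_sum (fun j _ => hx0 j) (Finset.mem_univ i)
  have hxy : ∀ i, |x i - y| ≤ 1 / n := fun i => by
    simpa [hx, hy] using abs_classCard_div_sub_le hn (k + 1) i
  have d2 : |classSum n (k + 1) 2 - y| ≤ 1 / n := by
    have : classSum n (k + 1) 2 - y = ∑ i, x i * (x i - y) := by
      have e : ∑ i, x i * (x i - y) = ∑ i, x i ^ 2 - (∑ i, x i) * y := by
        rw [Finset.sum_mul, ← Finset.sum_sub_distrib]
        exact Finset.sum_congr rfl fun i _ => by ring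
      rw [e, hsum, one_mul]; rfl
    rw [this]
    refine (Finset.abs_sum_le_sum_abs _ _).trans ?_
    calc ∑ i, |x i * (x i - y)| ≤ ∑ i, x i * (1 / n) := Finset.sum_le_sum fun i _ => by
          rw [abs_mul, abs_of_nonneg (hx0 i)]
          exact mul_le_mul_of_nonneg_left (hxy i) (hx0 i)
      _ = 1 / n := by rw [← Finset.sum_mul, hsum, one_mul]
  have d3 : |classSum n (k + 1) 3 - y ^ 2| ≤ 2 / n := by
    have : classSum n (k + 1) 3 - y ^ 2 = ∑ i, x i * ((x i + y) * (x i - y)) := by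
      have e : ∑ i, x i * ((x i + y) * (x i - y)) = ∑ i, x i ^ 3 - (∑ i, x i) * y ^ 2 := by
        rw [Finset.sum_mul, ← Finset.sum_sub_distrib]
        exact Finset.sum_congr rfl fun i _ => by ring
      rw [e, hsum, one_mul]; rfl
    rw [this]
    refine (Finset.abs_sum_le_sum_abs _ _).trans ?_
    calc ∑ i, |x i * ((x i + y) * (x i - y))| ≤ ∑ i, x i * (2 / n) :=
          Finset.sum_le_sum fun i _ => by
            rw [abs_mul, abs_of_nonneg (hx0 i), abs_mul, abs_of_nonneg (add_nonneg (hx0 i) hy0)]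
            refine mul_le_mul_of_nonneg_left ?_ (hx0 i)
            have h2 : x i + y ≤ 2 := by linarith [hx1 i]
            calc (x i + y) * |x i - y| ≤ 2 * (1 / n) :=
                  mul_le_mul h2 (hxy i) (abs_nonneg _) zero_le_two
              _ = 2 / n := by ring
      _ = 2 / n := by rw [← Finset.sum_mul, hsum, one_mul]
  rw [vn_eq hn, v_eq_turanPoint, turanPoint]
  refine (dist_euclidean_two_le _ _ _ _).trans ?_
  rw [← hy]
  rw [abs_le] at d2 d3
  have b1 : |1 - classSum n (k + 1) 2 - (1 - y)| ≤ 1 / n := by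
    rw [abs_le]; constructor <;> linarith [d2.1, d2.2]
  have b2 : |1 - 3 * classSum n (k + 1) 2 + 2 * classSum n (k + 1) 3 - (1 - 3 * y + 2 * y ^ 2)| ≤
      3 * (1 / (n : ℝ)) + 2 * (2 / n) := by
    rw [abs_le]; constructor <;> linarith [d2.1, d2.2, d3.1, d3.2]
  have : (8 : ℝ) / n = 1 / n + (3 * (1 / n) + 2 * (2 / n)) := by ring
  rw [this]
  exact add_le_add b1 b2

/-- The graphon that is identically one. -/
def oneGraphon : Graphon where
  toFun _ _ := 1
  measurable_toFun := measurable_const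
  symm _ _ := rfl
  mem_Icc _ _ := ⟨zero_le_one, le_rfl⟩

lemma tGraphon_oneGraphon : tGraphon oneGraphon = turanPoint 0 := by
  have h : ∀ m : ℕ, oneGraphon.homDensity (⊤ : SimpleGraph (Fin m)) = 1 := by
    intro m
    have h1 : ∀ (x : Fin m → I) (e : Sym2 (Fin m)), oneGraphon.pairValue x e = 1 := by
      intro x e
      induction e with
      | h i j => rfl
    simp [Graphon.homDensity, h1]
  rw [tGraphon, h, h, turanPoint]
  norm_num

/-- The convex hull of the density vectors of the Turán graphons and of the constant graphon. -/
def turanHull : Set (EuclideanSpace ℝ (Fin 2)) := convexHull ℝ (insert (turanPoint 0) (Set.range v))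

lemma continuous_turanPoint : Continuous turanPoint := by
  unfold turanPoint
  refine (PiLp.continuous_toLp 2 _).comp (continuous_pi fun i => ?_)
  fin_cases i
  · change Continuous fun x : ℝ => 1 - x
    fun_prop
  · change Continuous fun x : ℝ => 1 - 3 * x + 2 * x ^ 2
    fun_prop

/-- The vectors `v k` converge to `turanPoint 0`, so adding that point makes the generating set
compact. -/
lemma isCompact_turanHull : IsCompact turanHull := by
  refine isCompact_convexHull_of_isCompact (Tendsto.isCompact_insert_range ?_)
  have h := (continuous_turanPoint.tendsto 0).comp
    (tendsto_one_div_add_atTop_nhds_zero_nat (𝕜 := ℝ))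
  exact h.congr fun k => (v_eq_turanPoint k).symm

lemma Pn_subset_cthickening_turanHull {n : ℕ} (hn : 1 ≤ n) :
    Pn n ⊆ Metric.cthickening (8 / n) turanHull := by
  rw [Pn_eq_convexHull hn]
  have key : ∀ k, vn k n ∈ Metric.cthickening (8 / n) turanHull := fun k =>
    Metric.mem_cthickening_of_dist_le _ (v k) _ _
      (subset_convexHull ℝ _ (Or.inr ⟨k, rfl⟩)) (dist_vn_v_le hn k)
  refine convexHull_min ?_ ((convex_convexHull ℝ _).cthickening _)
  rintro x (⟨k, -, rfl⟩ | rfl)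
  · exact key k
  · exact key _

/-- For every `n ≥ 2`, `P` lies within `4 / n` of `Pn`, which lies within `8 / n` of `turanHull`; as
the latter is closed, it contains `P`. This gives compactness of `P` without showing that `R` is
closed. -/
theorem P_eq_turanHull : P = turanHull := by
  refine subset_antisymm (fun x hx => ?_) (convexHull_mono ?_)
  · rw [← isCompact_turanHull.isClosed.closure_eq, Metric.mem_closure_iff_infEDist_zero]
    have hlim : Tendsto (fun n : ℕ => ENNReal.ofReal (12 / n)) atTop (𝓝 0) := tendsto_const_div 12
    refine le_antisymm (ge_of_tendsto hlim ?_) zero_le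
    filter_upwards [eventually_ge_atTop 2] with n hn
    have h1 := Metric.cthickening_subset_of_subset (4 / n : ℝ)
      (Pn_subset_cthickening_turanHull (by omega : 1 ≤ n)) (P_subset_cthickening hn hx)
    have h2 := Metric.cthickening_cthickening_subset (ε := 4 / (n : ℝ)) (δ := 8 / (n : ℝ))
      (by positivity) (by positivity) turanHull h1
    rw [Metric.mem_cthickening_iff] at h2
    refine h2.trans_eq ?_
    congr 1
    ring
  · rintro x (rfl | ⟨k, rfl⟩)
    · exact ⟨oneGraphon, tGraphon_oneGraphon⟩
    · exact ⟨_, rfl⟩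

theorem isCompact_P : IsCompact P := P_eq_turanHull ▸ isCompact_turanHull

end Limit

end EdgeTriangle

end

theorem mainTheorem4 :
    (∀ n : ℕ, 1 ≤ n →
      EdgeTriangle.Pn n =
        convexHull ℝ ({x | ∃ k : ℕ, k < ⌈(n : ℝ) / 2⌉₊ ∧ x = EdgeTriangle.vn k n} ∪
          {EdgeTriangle.vn (n - 1) n})) ∧
    (IsCompact EdgeTriangle.P ∧
      Filter.Tendsto (fun n : ℕ => Metric.hausdorffEDist (EdgeTriangle.Pn n) EdgeTriangle.P)
        Filter.atTop (nhds 0)) ∧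
    (∀ k n : ℕ, 1 ≤ n → (k + 1) * (k + 2) ∣ n →
      EdgeTriangle.vn k n = EdgeTriangle.v k ∧
      EdgeTriangle.vn (k + 1) n = EdgeTriangle.v (k + 1) ∧
      (1 ≤ k →
        EdgeTriangle.Ln k n ∩ EdgeTriangle.S n =
          {EdgeTriangle.v k, EdgeTriangle.v (k + 1)})) := by
  refine ⟨fun n hn => EdgeTriangle.Pn_eq_convexHull hn,
    ⟨EdgeTriangle.isCompact_P, EdgeTriangle.tendsto_hausdorffEDist_Pn⟩, fun k n hn h => ?_⟩
  have h1 : EdgeTriangle.vn k n = EdgeTriangle.v k := by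
    rw [EdgeTriangle.v_eq_turanPoint, EdgeTriangle.vn_of_dvd hn (dvd_of_mul_right_dvd h)]
  have h2 : EdgeTriangle.vn (k + 1) n = EdgeTriangle.v (k + 1) := by
    rw [EdgeTriangle.v_eq_turanPoint, EdgeTriangle.vn_of_dvd hn (dvd_of_mul_left_dvd h)]
  exact ⟨h1, h2, fun hk => h1 ▸ h2 ▸ EdgeTriangle.Ln_inter_S hn h hk⟩
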